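/- For a real number $\beta>1$ let $T_\beta(x)=\{\beta x\}$ and $S_\beta(x)=1-\{\beta x\}$ for $x\in[0,1]$, where $\{y\}$ denotes the fractional part of $y$. Call $\beta$ a Parry number if the orbit $\{T_\beta^n(1):n\ge 0\}$ is finite, and a Yrrap number if the orbit $\{S_\beta^n(1):n\ge 0\}$ is finite. Let $P$ be the set of all Parry numbers, $Y$ the set of all Yrrap numbers, and write $A^c=\mathbb{R}\setminus A$. Then $P\cap Y^c$ and $P^c\cap Y$ are both countably infinite. Moreover, there are infinitely many $\beta\in P^c\cap Y$ that have a Galois conjugate over $\mathbb{Q}$, different from $\beta$, in the open interval $\bigl(1,\tfrac{1+\sqrt5}{2}\bigr)$. Furthermore, $P\cap Y^c$ is dense in $(1,\infty)$. -/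

import Mathlib

/-- The `β`-transformation `x ↦ {β x}`, a self-map of `[0, 1]`. -/
noncomputable def betaMap (β : ℝ) (x : ℝ) : ℝ := Int.fract (β * x)

/-- The negative `β`-transformation `x ↦ 1 - {β x}`, a self-map of `[0, 1]`. -/
noncomputable def negBetaMap (β : ℝ) (x : ℝ) : ℝ := 1 - Int.fract (β * x)

/-- The forward orbit `{T^n(x) : n ≥ 0}`. -/
def forwardOrbit (T : ℝ → ℝ) (x : ℝ) : Set ℝ := Set.range fun n : ℕ => T^[n] x

/-- The set of Parry numbers: the real `β > 1` for which the orbit of `1` under the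
`β`-transformation is finite. (Integers `β ≥ 2` belong to this set and to `yrrapNumbers`, so
they affect neither of the two set differences.) -/
def parryNumbers : Set ℝ := {β | 1 < β ∧ (forwardOrbit (betaMap β) 1).Finite}

/-- The set of Yrrap numbers: the real `β > 1` for which the orbit of `1` under the negative
`β`-transformation is finite. -/
def yrrapNumbers : Set ℝ := {β | 1 < β ∧ (forwardOrbit (negBetaMap β) 1).Finite}

open Polynomial Filter Topology

/-! Every point of either orbit of `1` is the value at `β` of an integer polynomial built by a
Horner recursion from the digits. If the orbit is finite, a difference of two of these polynomials
vanishes at `β`, and monotonicity in the index excludes other roots: in `(1, ∞)` for Parry numbers,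
in `(-∞, -1]` for Yrrap numbers. This gives countability, and a conjugate in the excluded region
disproves membership.

Yrrap but not Parry: `yrrapCubic N` has a root in `(N - 1, N)` whose orbit of `1` falls into a
2-cycle, and a conjugate root between `1` and the golden ratio.

Parry but not Yrrap: numbers `b₀` whose orbit of `1` reaches `0` are dense. Appending sparse digits
`1` to that expansion gives a nearby `b`, root of `f = X ^ n * g - 1`, whose orbit still reaches
`0`, while `f` has a root `γ < -1` and is negative on `[-1, 0]`. Since `f` may be reducible, `γ`
must be shown to be a root of the minimal polynomial `m` of `b`. Write `f = m * q` and let `w` be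
`m` times the reversal of `q`. Then `w` and `f` have equal autocorrelation, so the number of terms
of `w` is bounded independently of `n`. For large `n` the exponents carry an additive weight
separating `1` from `X ^ n * g`; it lifts the autocorrelation identity to two variables, and
restriction to the curve `y * x ^ n * g(x) = 1` forces `f ∣ w` (`exists_forall_dvd_mul_reflect`). So
`γ` is a root of `m`, or `γ⁻¹ ∈ (-1, 0)` is a root of `q`; the sign of `f` rules out the latter. -/

/-! ### Orbits as polynomial values, and excluded roots -/

/-- The polynomials obtained from `1` by the Horner-type steps `p ↦ ε X p + d k`. -/
noncomputable def hornerPoly (ε : ℤ) (d : ℕ → ℤ) : ℕ → ℤ[X]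
  | 0 => 1
  | k + 1 => C ε * X * hornerPoly ε d k + C (d k)

theorem aeval_hornerPoly_succ (ε : ℤ) (d : ℕ → ℤ) (k : ℕ) (x : ℝ) :
    aeval x (hornerPoly ε d (k + 1)) = ε * x * aeval x (hornerPoly ε d k) + d k := by
  simp [hornerPoly]

/-- The digits (with a sign) of `1` for the `β`-transformation. -/
noncomputable def betaDigit (β : ℝ) (k : ℕ) : ℤ := -⌊β * (betaMap β)^[k] 1⌋

/-- The digits of `1` for the negative `β`-transformation. -/
noncomputable def negBetaDigit (β : ℝ) (k : ℕ) : ℤ := ⌊β * (negBetaMap β)^[k] 1⌋ + 1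

theorem aeval_hornerPoly_betaDigit (β : ℝ) (k : ℕ) :
    aeval β (hornerPoly 1 (betaDigit β) k) = (betaMap β)^[k] 1 := by
  induction k with
  | zero => simp [hornerPoly]
  | succ k ih =>
    rw [aeval_hornerPoly_succ, ih, Function.iterate_succ_apply']
    rw [betaMap, betaDigit, Int.fract]
    push_cast
    ring

theorem aeval_hornerPoly_negBetaDigit (β : ℝ) (k : ℕ) :
    aeval β (hornerPoly (-1) (negBetaDigit β) k) = (negBetaMap β)^[k] 1 := by
  induction k with
  | zero => simp [hornerPoly]
  | succ k ih =>
    rw [aeval_hornerPoly_succ, ih, Function.iterate_succ_apply']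
    rw [negBetaMap, negBetaDigit, Int.fract]
    push_cast
    ring

theorem exists_lt_iterate_eq_of_finite_forwardOrbit {T : ℝ → ℝ} {x : ℝ}
    (h : (forwardOrbit T x).Finite) : ∃ n k, n < k ∧ T^[n] x = T^[k] x := by
  have : ¬ Function.Injective fun n : ℕ => T^[n] x := fun hi =>
    Set.infinite_range_of_injective hi h
  simp only [Function.Injective, not_forall] at this
  obtain ⟨a, b, hab, hne⟩ := this
  rcases lt_or_gt_of_ne hne with h | h
  · exact ⟨a, b, h, hab⟩
  · exact ⟨b, a, h, hab.symm⟩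

theorem betaMap_iterate_nonneg (β : ℝ) (k : ℕ) : 0 ≤ (betaMap β)^[k] 1 := by
  cases k with
  | zero => simp
  | succ k => rw [Function.iterate_succ_apply']; exact Int.fract_nonneg _

theorem betaMap_iterate_lt_one (β : ℝ) (k : ℕ) : (betaMap β)^[k + 1] 1 < 1 := by
  rw [Function.iterate_succ_apply']; exact Int.fract_lt_one _

theorem negBetaMap_iterate_pos (β : ℝ) (k : ℕ) : 0 < (negBetaMap β)^[k] 1 := by
  cases k with
  | zero => simp
  | succ k =>
    rw [Function.iterate_succ_apply']
    have := Int.fract_lt_one (β * (negBetaMap β)^[k] 1)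
    simp only [negBetaMap] at *
    linarith

/-- A Yrrap number is a root of an integer polynomial without roots in `(-∞, -1]`. -/
theorem exists_aeval_ne_zero_of_mem_yrrapNumbers {β : ℝ} (h : β ∈ yrrapNumbers) :
    ∃ p : ℤ[X], aeval β p = 0 ∧ ∀ x : ℝ, x ≤ -1 → aeval x p ≠ 0 := by
  obtain ⟨hβ, hfin⟩ := h
  obtain ⟨n, k, hnk, heq⟩ := exists_lt_iterate_eq_of_finite_forwardOrbit hfin
  refine ⟨hornerPoly (-1) (negBetaDigit β) n - hornerPoly (-1) (negBetaDigit β) k, ?_, ?_⟩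
  · rw [map_sub, aeval_hornerPoly_negBetaDigit, aeval_hornerPoly_negBetaDigit, heq, sub_self]
  · intro x hx
    have hd : ∀ j, (1 : ℝ) ≤ negBetaDigit β j := fun j => by
      have : 0 ≤ ⌊β * (negBetaMap β)^[j] 1⌋ :=
        Int.floor_nonneg.2 (mul_nonneg (by linarith) (negBetaMap_iterate_pos β j).le)
      have : (1 : ℤ) ≤ negBetaDigit β j := by unfold negBetaDigit; linarith
      exact_mod_cast this
    -- A step multiplies by `-x ≥ 1` and adds a digit at least `1`.
    have hpos : ∀ j, 0 < aeval x (hornerPoly (-1) (negBetaDigit β) j) := fun j => by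
      induction j with
      | zero => simp [hornerPoly]
      | succ j ih =>
        rw [aeval_hornerPoly_succ]
        have := hd j
        push_cast
        nlinarith
    have hmono : StrictMono fun j => aeval x (hornerPoly (-1) (negBetaDigit β) j) :=
      strictMono_nat_of_lt_succ fun j => by
        rw [aeval_hornerPoly_succ]
        have := hd j
        have := hpos j
        push_cast
        nlinarith
    have := hmono hnk
    rw [map_sub]
    exact (sub_neg.2 this).ne

/-- The digits cancel in the difference, so a step multiplies it by `x` and adds `x - β` times an
orbit point, which is nonnegative. -/
theorem hornerPoly_betaDigit_sub_growth {β x : ℝ} (hβ : 1 < β) (hx : β < x) (k : ℕ) :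
    x ^ k * (x - β) ≤ aeval x (hornerPoly 1 (betaDigit β) (k + 1)) -
      aeval β (hornerPoly 1 (betaDigit β) (k + 1)) := by
  induction k with
  | zero => simp [hornerPoly]
  | succ k ih =>
    rw [aeval_hornerPoly_succ, aeval_hornerPoly_succ _ _ (k + 1) β]
    have h0 := betaMap_iterate_nonneg β (k + 1)
    rw [← aeval_hornerPoly_betaDigit] at h0
    have hx0 : 0 < x := by linarith
    have := mul_le_mul_of_nonneg_left ih hx0.le
    have := mul_nonneg (sub_nonneg.2 hx.le) h0
    push_cast
    rw [pow_succ]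
    nlinarith

/-- A Parry number is a root of an integer polynomial without other roots in `(1, ∞)`. -/
theorem exists_aeval_ne_zero_of_mem_parryNumbers {β : ℝ} (h : β ∈ parryNumbers) :
    ∃ p : ℤ[X], aeval β p = 0 ∧ ∀ x : ℝ, 1 < x → x ≠ β → aeval x p ≠ 0 := by
  obtain ⟨hβ, hfin⟩ := h
  obtain ⟨n, k, hnk, heq⟩ := exists_lt_iterate_eq_of_finite_forwardOrbit hfin
  set P := hornerPoly 1 (betaDigit β) with hP
  have hPβ : ∀ j, 0 ≤ aeval β (P j) := fun j => by
    rw [hP, aeval_hornerPoly_betaDigit]; exact betaMap_iterate_nonneg β j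
  have heq' : aeval β (P n) = aeval β (P k) := by
    rw [hP, aeval_hornerPoly_betaDigit, aeval_hornerPoly_betaDigit, heq]
  have hs : ∀ j (y : ℝ), aeval y (P (j + 1)) = y * aeval y (P j) + betaDigit β j := fun j y => by
    rw [hP, aeval_hornerPoly_succ]; simp
  have h0 : ∀ y : ℝ, aeval y (P 0) = 1 := fun y => by simp [hP, hornerPoly]
  refine ⟨P n - P k, by rw [map_sub, heq', sub_self], ?_⟩
  intro x hx hne
  rw [map_sub]
  rcases lt_or_gt_of_ne hne with hlt | hgt
  -- A step turns the gap `D` into `x * D + (β - x) * P_j(β)`, with `x > 1` and `P_j(β) ≥ 0`. It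
  -- starts at `0` and becomes `β - x` after one step.
  · have key : ∀ j, 0 ≤ aeval β (P j) - aeval x (P j) ∧
        aeval β (P j) - aeval x (P j) < aeval β (P (j + 1)) - aeval x (P (j + 1)) := fun j => by
      induction j with
      | zero => rw [hs, hs, h0, h0]; constructor <;> linarith
      | succ j ih =>
        have hpos : 0 < aeval β (P (j + 1)) - aeval x (P (j + 1)) := ih.1.trans_lt ih.2
        refine ⟨hpos.le, ?_⟩
        rw [hs (j + 1), hs (j + 1)]
        have := mul_nonneg (sub_nonneg.2 hlt.le) (hPβ (j + 1))
        nlinarith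
    have hm : StrictMono fun j => aeval β (P j) - aeval x (P j) :=
      strictMono_nat_of_lt_succ fun j => (key j).2
    have h1 := hm hnk
    simp only at h1
    intro h2
    linarith
  · have key : ∀ j, 0 ≤ aeval x (P j) - aeval β (P j) ∧
        aeval x (P j) - aeval β (P j) < aeval x (P (j + 1)) - aeval β (P (j + 1)) := fun j => by
      induction j with
      | zero => rw [hs, hs, h0, h0]; constructor <;> linarith
      | succ j ih =>
        have hpos : 0 < aeval x (P (j + 1)) - aeval β (P (j + 1)) := ih.1.trans_lt ih.2
        refine ⟨hpos.le, ?_⟩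
        rw [hs (j + 1), hs (j + 1)]
        have := mul_nonneg (sub_nonneg.2 hgt.le) (hPβ (j + 1))
        nlinarith
    have hm : StrictMono fun j => aeval x (P j) - aeval β (P j) :=
      strictMono_nat_of_lt_succ fun j => (key j).2
    have h1 := hm hnk
    simp only at h1
    intro h2
    linarith

theorem countable_parryNumbers : parryNumbers.Countable := by
  refine (Algebraic.countable ℤ ℝ).mono fun β h => ?_
  obtain ⟨p, hp, hne⟩ := exists_aeval_ne_zero_of_mem_parryNumbers h
  refine ⟨p, ?_, hp⟩
  rintro rfl
  exact hne (β + 1) (by linarith [h.1]) (by linarith) (by simp)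

theorem countable_yrrapNumbers : yrrapNumbers.Countable := by
  refine (Algebraic.countable ℤ ℝ).mono fun β h => ?_
  obtain ⟨p, hp, hne⟩ := exists_aeval_ne_zero_of_mem_yrrapNumbers h
  refine ⟨p, ?_, hp⟩
  rintro rfl
  exact hne (-1) le_rfl (by simp)

/-! ### Yrrap numbers that are not Parry numbers -/

theorem IsConjRoot.aeval_int_eq_zero {β γ : ℝ} (h : IsConjRoot ℚ β γ) {p : ℤ[X]}
    (hp : aeval β p = 0) : aeval γ p = 0 := by
  have h1 : aeval β (p.map (algebraMap ℤ ℚ)) = 0 := by rwa [aeval_map_algebraMap]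
  have h2 : minpoly ℚ γ ∣ p.map (algebraMap ℤ ℚ) := by
    rw [← show minpoly ℚ β = minpoly ℚ γ from h]; exact minpoly.dvd ℚ β h1
  rw [← aeval_map_algebraMap ℚ]
  exact aeval_eq_zero_of_dvd_aeval_eq_zero h2 (minpoly.aeval ℚ γ)

theorem notMem_parryNumbers_of_isConjRoot {β γ : ℝ} (h : IsConjRoot ℚ β γ) (hne : γ ≠ β)
    (hγ : 1 < γ) : β ∉ parryNumbers := fun hβ => by
  obtain ⟨p, hp, hr⟩ := exists_aeval_ne_zero_of_mem_parryNumbers hβ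
  exact hr γ hγ hne (h.aeval_int_eq_zero hp)

/-- The cubic `X³ - N X² + X + (N - 1)`. -/
noncomputable def yrrapCubic (N : ℤ) : ℤ[X] := X ^ 3 - C N * X ^ 2 + X + C (N - 1)

theorem aeval_yrrapCubic (N : ℤ) (x : ℝ) :
    aeval x (yrrapCubic N) = x ^ 3 - N * x ^ 2 + x + (N - 1) := by
  simp [yrrapCubic]

theorem yrrapCubic_eval_ne_zero {N : ℤ} (hN : 4 ≤ N) (r : ℤ) : (yrrapCubic N).eval r ≠ 0 := by
  intro h
  have h : r ^ 3 - N * r ^ 2 + r + (N - 1) = 0 := by simpa [yrrapCubic] using h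
  have h1 : (r ^ 2 - 1) * (N - r) = 2 * r - 1 := by linarith
  rcases le_or_gt r (-2) with hr | hr
  · have := mul_pos (by nlinarith : 0 < r ^ 2 - 1) (by linarith : 0 < N - r)
    linarith
  rcases le_or_gt r 2 with hr2 | hr2
  · interval_cases r <;> omega
  · rcases le_or_gt N r with hNr | hNr
    · nlinarith
    · have := mul_nonneg (by nlinarith : 0 ≤ r ^ 2 - 1) (by linarith : 0 ≤ N - r - 1)
      nlinarith

theorem yrrapCubic_monic (N : ℤ) : (yrrapCubic N).Monic := by
  unfold yrrapCubic; monicity!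

theorem yrrapCubic_natDegree (N : ℤ) : (yrrapCubic N).natDegree = 3 := by
  unfold yrrapCubic; compute_degree!

theorem irreducible_yrrapCubic_map {N : ℤ} (hN : 4 ≤ N) :
    Irreducible ((yrrapCubic N).map (algebraMap ℤ ℚ)) := by
  have hd : ((yrrapCubic N).map (algebraMap ℤ ℚ)).natDegree = 3 := by
    rw [(yrrapCubic_monic N).natDegree_map, yrrapCubic_natDegree]
  refine Polynomial.irreducible_of_degree_le_three_of_not_isRoot (by rw [hd]; decide) fun x hx => ?_
  have hx' : aeval x (yrrapCubic N) = 0 := by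
    rwa [IsRoot.def, eval_map, ← aeval_def] at hx
  obtain ⟨r, rfl⟩ := isInteger_of_is_root_of_monic (yrrapCubic_monic N) hx'
  rw [aeval_algebraMap_apply] at hx'
  refine yrrapCubic_eval_ne_zero hN r ?_
  have : aeval r (yrrapCubic N) = 0 := (algebraMap ℤ ℚ).injective_int (by simpa using hx')
  simpa using this

theorem isConjRoot_of_yrrapCubic {N : ℤ} (hN : 4 ≤ N) {β γ : ℝ}
    (hβ : aeval β (yrrapCubic N) = 0) (hγ : aeval γ (yrrapCubic N) = 0) : IsConjRoot ℚ β γ := by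
  have hm := (yrrapCubic_monic N).map (algebraMap ℤ ℚ)
  have h := irreducible_yrrapCubic_map hN
  have h1 := minpoly.eq_of_irreducible_of_monic h
    (show aeval β ((yrrapCubic N).map (algebraMap ℤ ℚ)) = 0 by rwa [aeval_map_algebraMap]) hm
  have h2 := minpoly.eq_of_irreducible_of_monic h
    (show aeval γ ((yrrapCubic N).map (algebraMap ℤ ℚ)) = 0 by rwa [aeval_map_algebraMap]) hm
  exact h1.symm.trans h2

/-- The orbit is `1 ↦ x₁ ↦ x₂ ↦ x₁`; the cubic equation is exactly the condition `β * x₁ = 2 - x₂`.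
-/
theorem mem_yrrapNumbers_of_yrrapCubic {N : ℤ} (hN : 4 ≤ N) {β : ℝ} (h1 : (N : ℝ) - 1 < β)
    (h2 : β < N) (h : aeval β (yrrapCubic N) = 0) : β ∈ yrrapNumbers := by
  have hN' : (4 : ℝ) ≤ N := by exact_mod_cast hN
  rw [aeval_yrrapCubic] at h
  have hβ : 0 < β := by linarith
  refine ⟨by linarith, ?_⟩
  set x₁ : ℝ := N - β with hx₁
  set x₂ : ℝ := (1 - x₁) / β with hx₂
  have hx₂β : β * x₂ = 1 - x₁ := by rw [hx₂]; field_simp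
  have e1 : negBetaMap β 1 = x₁ := by
    have : ⌊β * 1⌋ = N - 1 := by
      rw [Int.floor_eq_iff]; push_cast; constructor <;> linarith
    rw [negBetaMap, Int.fract, this]; push_cast; rw [hx₁]; ring
  have e2 : negBetaMap β x₁ = x₂ := by
    have hb : β * x₁ = 2 - x₂ := by
      have : β * (β * x₁) = β * (2 - x₂) := by
        rw [mul_sub β 2 x₂, hx₂β, hx₁]; linarith
      exact mul_left_cancel₀ hβ.ne' this
    have p1 : 0 < x₂ := div_pos (by linarith) hβ
    have p2 : x₂ < 1 := by rw [hx₂, div_lt_one hβ]; linarith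
    have : ⌊β * x₁⌋ = 1 := by
      rw [Int.floor_eq_iff, hb]; push_cast; constructor <;> linarith
    rw [negBetaMap, Int.fract, this, hb]; push_cast; ring
  have e3 : negBetaMap β x₂ = x₁ := by
    have : ⌊β * x₂⌋ = 0 := by
      rw [Int.floor_eq_iff, hx₂β]; push_cast; constructor <;> linarith
    rw [negBetaMap, Int.fract, this, hx₂β]; push_cast; ring
  refine Set.Finite.subset (Set.toFinite {1, x₁, x₂}) ?_
  rintro _ ⟨n, rfl⟩
  induction n with
  | zero => simp
  | succ n ih =>
    simp only [Function.iterate_succ_apply']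
    simp only [Set.mem_insert_iff, Set.mem_singleton_iff] at ih ⊢
    rcases ih with ih | ih | ih <;> rw [ih] <;> simp [e1, e2, e3]

theorem exists_mem_yrrapNumbers_conj (N : ℤ) (hN : 4 ≤ N) :
    ∃ β : ℝ, (N : ℝ) - 1 < β ∧ β < N ∧ β ∈ parryNumbersᶜ ∩ yrrapNumbers ∧
      ∃ γ : ℝ, IsConjRoot ℚ β γ ∧ γ ≠ β ∧ 1 < γ ∧ γ < Real.goldenRatio := by
  have hN' : (4 : ℝ) ≤ N := by exact_mod_cast hN
  have hc : Continuous fun x : ℝ => aeval x (yrrapCubic N) := (yrrapCubic N).continuous_aeval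
  obtain ⟨β, ⟨h1, h2⟩, hβ⟩ := intermediate_value_Ioo (by linarith : (N : ℝ) - 1 ≤ N)
    hc.continuousOn (show (0 : ℝ) ∈ Set.Ioo _ _ by
      simp only [aeval_yrrapCubic]; constructor <;> nlinarith)
  have hφ := Real.goldenRatio_sq
  have hφ1 := Real.one_lt_goldenRatio
  have hφ2 := Real.goldenRatio_lt_two
  -- The cubic equals `1` at `1` and `(3 - N) * φ` at the golden ratio `φ`.
  obtain ⟨γ, ⟨h3, h4⟩, hγ⟩ := intermediate_value_Ioo' hφ1.le
    hc.continuousOn (show (0 : ℝ) ∈ Set.Ioo _ _ by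
      simp only [aeval_yrrapCubic]; constructor <;> nlinarith)
  have hconj := isConjRoot_of_yrrapCubic hN hβ hγ
  have hne : γ ≠ β := by linarith
  exact ⟨β, h1, h2, ⟨notMem_parryNumbers_of_isConjRoot hconj hne h3,
    mem_yrrapNumbers_of_yrrapCubic hN h1 h2 hβ⟩, γ, hconj, hne, h3, h4⟩

theorem infinite_yrrapNumbers_conj :
    {β : ℝ | β ∈ parryNumbersᶜ ∩ yrrapNumbers ∧
      ∃ γ : ℝ, IsConjRoot ℚ β γ ∧ γ ≠ β ∧ 1 < γ ∧ γ < Real.goldenRatio}.Infinite := by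
  choose f hf using fun n : ℕ => exists_mem_yrrapNumbers_conj (n + 4) (by omega)
  refine Set.infinite_of_injective_forall_mem (f := f) ?_ fun n => (hf n).2.2
  refine (strictMono_nat_of_lt_succ fun n => ?_).injective
  have h1 := (hf n).2.1
  have h2 := (hf (n + 1)).1
  push_cast at h1 h2
  linarith

/-! ### Additive weights and the lift to two variables -/

/-- Sparse sets of exponents of large diameter carry weights in `[0, 1]` which respect all
coincidences between differences, vanish at `0` and are `1` near the upper end. -/
theorem exists_additive_weight (K l : ℕ) : ∃ N, ∀ n ≥ N, ∀ E : Finset ℕ, E.card ≤ K →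
    (∀ e ∈ E, e ≤ n + l) → ∃ A : ℕ → ℝ, (∀ e ∈ E, 0 ≤ A e ∧ A e ≤ 1) ∧ (0 ∈ E → A 0 = 0) ∧
      (∀ e ∈ E, n ≤ e → A e = 1) ∧
      ∀ a ∈ E, ∀ b ∈ E, ∀ c ∈ E, ∀ d ∈ E, a + d = c + b → A a + A d = A c + A b := by
  -- Compactness: from counterexamples with `n` unbounded, the weights are the limits of the
  -- rescaled exponents `e / (n + l)` along an ultrafilter.
  by_contra hcon
  push Not at hcon
  choose n hn E hEK hEn hE using hcon
  set ε : ℕ → Fin K → ℕ := fun i j => (E i).toList.getD j 0 with hε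
  have hεmem : ∀ i, ∀ e ∈ E i, ∃ j, ε i j = e := fun i e he => by
    obtain ⟨k, hk, rfl⟩ := List.mem_iff_getElem.1 (Finset.mem_toList.2 he)
    have hk' : k < K := by
      rw [Finset.length_toList] at hk; exact hk.trans_le (hEK i)
    exact ⟨⟨k, hk'⟩, List.getD_eq_getElem _ _ hk⟩
  have hεle : ∀ i j, ε i j ≤ n i + l := fun i j => by
    by_cases hj : (j : ℕ) < (E i).toList.length
    · refine hEn i _ (Finset.mem_toList.1 ?_)
      simp only [hε, List.getD_eq_getElem _ _ hj]
      exact List.getElem_mem hj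
    · simp only [hε, List.getD_eq_default _ _ (not_lt.1 hj), Nat.zero_le]
  set U : Ultrafilter ℕ := hyperfilter ℕ
  have hU : (U : Filter ℕ) ≤ atTop := Nat.hyperfilter_le_atTop
  set r : Fin K → ℕ → ℝ := fun j i => (ε i j : ℝ) / ((n i + l : ℕ) : ℝ) with hr
  have hr01 : ∀ j i, r j i ∈ Set.Icc (0 : ℝ) 1 := fun j i =>
    ⟨by positivity, div_le_one_of_le₀ (by exact_mod_cast hεle i j) (by positivity)⟩
  have hlim : ∀ j, ∃ α ∈ Set.Icc (0 : ℝ) 1, Tendsto (r j) U (𝓝 α) := fun j =>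
    isCompact_Icc.ultrafilter_le_nhds (U.map (r j))
      (le_principal_iff.2 (Filter.mem_map.2 (Filter.univ_mem' (hr01 j))))
  choose α hα hlim using hlim
  -- Only finitely many relations occur among `K` indices, and the ultrafilter decides each one.
  -- Those holding almost everywhere pass to the limit; the others fail almost everywhere.
  have dich : ∀ (Q : ℕ → Prop) (C : Prop), ((∀ᶠ i in U, Q i) → C) → ∀ᶠ i in U, Q i → C := by
    intro Q C h
    by_cases hC : C
    · exact Filter.Eventually.of_forall fun _ _ => hC
    · have : ∀ᶠ i in U, ¬ Q i := Ultrafilter.eventually_not.2 fun hq => hC (h hq)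
      exact this.mono fun i hi hq => (hi hq).elim
  have e1 : ∀ᶠ i in U, ∀ a b c d : Fin K, ε i a + ε i d = ε i c + ε i b →
      α a + α d = α c + α b := by
    simp only [Filter.eventually_all]
    intro a b c d
    refine dich _ _ fun h => ?_
    refine tendsto_nhds_unique (((hlim a).add (hlim d)).congr' ?_) ((hlim c).add (hlim b))
    filter_upwards [h] with i hi
    simp only [hr, ← add_div]
    congr 1
    exact_mod_cast hi
  have e2 : ∀ᶠ i in U, ∀ a : Fin K, ε i a = 0 → α a = 0 := by
    simp only [Filter.eventually_all]
    intro a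
    refine dich _ _ fun h => ?_
    refine tendsto_nhds_unique (hlim a) (tendsto_const_nhds.congr' ?_)
    filter_upwards [h] with i hi
    simp [hr, hi]
  have hn1 : Tendsto (fun i => 1 - (l : ℝ) / ((n i + l : ℕ) : ℝ)) U (𝓝 1) := by
    have h1 : Tendsto (fun i => n i + l) U atTop :=
      tendsto_atTop_mono (fun i => (hn i).trans (Nat.le_add_right _ _)) (tendsto_id.mono_left hU)
    have := (tendsto_const_nhds (x := (l : ℝ))).div_atTop
      (tendsto_natCast_atTop_atTop (R := ℝ) |>.comp h1)
    simpa using this.const_sub 1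
  have e3 : ∀ᶠ i in U, ∀ a : Fin K, n i ≤ ε i a → α a = 1 := by
    simp only [Filter.eventually_all]
    intro a
    refine dich _ _ fun h => le_antisymm (hα a).2 (le_of_tendsto_of_tendsto hn1 (hlim a) ?_)
    filter_upwards [h, hU (eventually_gt_atTop 0)] with i hi hi0
    have h0 : (0 : ℝ) < ((n i + l : ℕ) : ℝ) := by
      have := hn i; exact_mod_cast (by omega : 0 < n i + l)
    simp only [hr]
    rw [one_sub_div h0.ne']
    gcongr
    push_cast
    have : (n i : ℝ) ≤ ε i a := by exact_mod_cast hi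
    linarith
  obtain ⟨i, h1, h2, h3⟩ := (e1.and (e2.and e3)).exists
  have hchoice : ∃ A : ℕ → ℝ, ∀ j, A (ε i j) = α j := by
    classical
    refine ⟨fun e => if h : ∃ j, ε i j = e then α h.choose else 0, fun j => ?_⟩
    have h : ∃ k, ε i k = ε i j := ⟨j, rfl⟩
    simp only [h, dif_pos]
    have := h1 h.choose j j j (by rw [h.choose_spec])
    linarith
  obtain ⟨A, hA⟩ := hchoice
  obtain ⟨a, ha, b, hb, c, hc, d, hd, hrel, hne⟩ := hE i A
    (fun e he => by obtain ⟨j, rfl⟩ := hεmem i e he; rw [hA]; exact hα j)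
    (fun he => by obtain ⟨j, hj⟩ := hεmem i 0 he; rw [← hj, hA]; exact h2 j hj)
    (fun e he hle => by obtain ⟨j, rfl⟩ := hεmem i e he; rw [hA]; exact h3 j hle)
  obtain ⟨a, rfl⟩ := hεmem i a ha
  obtain ⟨b, rfl⟩ := hεmem i b hb
  obtain ⟨c, rfl⟩ := hεmem i c hc
  obtain ⟨d, rfl⟩ := hεmem i d hd
  rw [hA, hA, hA, hA] at hne
  exact hne (h1 a b c d hrel)

/-- If `w` and `f` have the same autocorrelation, then so do their lifts to two variables along
a weight which is additive on the exponents. -/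
theorem weighted_autocorrelation_eq {w f : ℤ[X]} {D : ℕ} {E : Finset ℕ}
    (hE : ∀ e ∈ E, e ≤ D) (hw : w.support ⊆ E) (hf : f.support ⊆ E)
    (h : w * w.reflect D = f * f.reflect D) {A : ℕ → ℝ}
    (hA : ∀ a ∈ E, ∀ b ∈ E, ∀ c ∈ E, ∀ d ∈ E, a + d = c + b → A a + A d = A c + A b)
    {x y : ℝ} (hx : 0 < x) (hy : 0 < y) :
    (∑ e ∈ E, w.coeff e * x ^ e * y ^ A e) * (∑ e ∈ E, w.coeff e * x⁻¹ ^ e * y ^ (-A e)) =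
      (∑ e ∈ E, f.coeff e * x ^ e * y ^ A e) * (∑ e ∈ E, f.coeff e * x⁻¹ ^ e * y ^ (-A e)) := by
  classical
  -- Additivity makes `A a - A b` a function of the product exponent `a + (D - b)` alone, so the
  -- lifted product is a linear functional `Λ` of the autocorrelation.
  have hB : ∃ B : ℕ → ℝ, ∀ a ∈ E, ∀ b ∈ E, B (a + (D - b)) = A a - A b := by
    refine ⟨fun k => if h : ∃ p : ℕ × ℕ, p.1 ∈ E ∧ p.2 ∈ E ∧ p.1 + (D - p.2) = k then
      A h.choose.1 - A h.choose.2 else 0, fun a ha b hb => ?_⟩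
    have h : ∃ p : ℕ × ℕ, p.1 ∈ E ∧ p.2 ∈ E ∧ p.1 + (D - p.2) = a + (D - b) :=
      ⟨(a, b), ha, hb, rfl⟩
    simp only [h, dif_pos]
    obtain ⟨h1, h2, h3⟩ := h.choose_spec
    have := hE _ h2
    have := hE _ hb
    have := hA _ h1 _ h2 a ha b hb (by omega)
    linarith
  obtain ⟨B, hB⟩ := hB
  set Λ : ℤ[X] → ℝ := fun p => ∑ k ∈ Finset.range (2 * D + 1), p.coeff k * (x ^ k * y ^ B k)
  have hsum : ∀ p : ℤ[X], p.support ⊆ E → p = ∑ e ∈ E, monomial e (p.coeff e) := fun p hp => by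
    conv_lhs => rw [p.as_sum_support]
    exact Finset.sum_subset hp fun e _ he => by simp [notMem_support_iff.1 he]
  have hrefl : ∀ p : ℤ[X], p.support ⊆ E →
      p.reflect D = ∑ e ∈ E, monomial (D - e) (p.coeff e) := fun p hp => by
    ext k
    rw [coeff_reflect, finsetSum_coeff]
    simp only [coeff_monomial]
    by_cases hk : k ≤ D
    · rw [revAt_le hk]
      have : ∀ e ∈ E, (if D - e = k then p.coeff e else 0) =
          if e = D - k then p.coeff e else 0 := fun e he => by
        have := hE e he
        congr 1
        exact propext ⟨fun _ => by omega, fun _ => by omega⟩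
      rw [Finset.sum_congr rfl this, Finset.sum_ite_eq' E]
      split_ifs with hm
      · rfl
      · exact notMem_support_iff.1 fun h' => hm (hp h')
    · rw [revAt_eq_self_of_lt (not_le.1 hk), Finset.sum_eq_zero fun e he => if_neg (by omega)]
      exact notMem_support_iff.1 fun h' => hk (hE _ (hp h'))
  have key : ∀ p : ℤ[X], p.support ⊆ E → x ^ D *
      ((∑ e ∈ E, p.coeff e * x ^ e * y ^ A e) * (∑ e ∈ E, p.coeff e * x⁻¹ ^ e * y ^ (-A e))) =
      Λ (p * p.reflect D) := fun p hp => by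
    have h1 : ∀ k, (p * p.reflect D).coeff k =
        ∑ a ∈ E, ∑ b ∈ E, if a + (D - b) = k then p.coeff a * p.coeff b else 0 := fun k => by
      have hmul := congrArg₂ (· * ·) (hsum p hp) (hrefl p hp)
      rw [hmul, Finset.sum_mul_sum, finsetSum_coeff]
      refine Finset.sum_congr rfl fun a ha => ?_
      rw [finsetSum_coeff]
      refine Finset.sum_congr rfl fun b hb => ?_
      rw [monomial_mul_monomial, coeff_monomial]
    rw [Finset.sum_mul_sum, Finset.mul_sum]
    simp only [Λ, h1]
    push_cast
    simp only [Finset.sum_mul]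
    rw [Finset.sum_comm]
    refine Finset.sum_congr rfl fun a ha => ?_
    rw [Finset.sum_comm, Finset.mul_sum]
    refine Finset.sum_congr rfl fun b hb => ?_
    have ha' := hE a ha
    have hb' := hE b hb
    rw [Finset.sum_eq_single (a + (D - b)) (fun k _ hk => by rw [if_neg hk.symm]; simp)
      (fun h' => (h' (Finset.mem_range.2 (by omega))).elim), if_pos rfl, hB a ha b hb,
      sub_eq_add_neg, Real.rpow_add hy, pow_add]
    have : x ^ D = x ^ (D - b) * x ^ b := by rw [← pow_add]; congr 1; omega
    rw [this, inv_pow]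
    field_simp
  have := (key w hw).trans ((congrArg Λ h).trans (key f hf).symm)
  exact mul_left_cancel₀ (pow_pos hx D).ne' this

/-- Powers with distinct exponents in `[0, 1)` of a polynomial with a simple zero are linearly
independent over the polynomials. -/
theorem eq_zero_of_sum_mul_rpow_eq_zero {Y : ℝ[X]} {β : ℝ} (hY : Y.IsRoot β)
    (hY' : Y.derivative.eval β ≠ 0) (hpos : ∀ x, β < x → 0 < Y.eval x) {S : Finset ℝ}
    (hS : ∀ s ∈ S, 0 ≤ s ∧ s < 1) {H : ℝ → ℝ[X]}
    (h : ∀ x, β < x → ∑ s ∈ S, (H s).eval x * Y.eval x ^ s = 0) : ∀ s ∈ S, H s = 0 := by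
  classical
  obtain ⟨Z, hZ⟩ := dvd_iff_isRoot.2 hY
  have hZβ : Z.eval β ≠ 0 := by
    intro h0; apply hY'; rw [hZ]; simp [h0]
  have hZpos : ∀ x, β < x → 0 < Z.eval x := fun x hx => by
    have := hpos x hx
    rw [hZ, eval_mul] at this
    simp only [eval_sub, eval_X, eval_C] at this
    exact pos_of_mul_pos_right this (by linarith)
  have hlimZ : Tendsto (fun x => Z.eval x) (𝓝[>] β) (𝓝 (Z.eval β)) :=
    Z.continuous.continuousAt.mono_left nhdsWithin_le_nhds
  have hZβpos : 0 < Z.eval β := lt_of_le_of_ne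
    (ge_of_tendsto hlimZ (eventually_nhdsWithin_of_forall fun x hx => (hZpos x hx).le)) hZβ.symm
  by_contra hne
  push Not at hne
  set S' := S.filter fun s => H s ≠ 0 with hS'
  have hne' : S'.Nonempty := by
    obtain ⟨s, hs, hs0⟩ := hne
    exact ⟨s, Finset.mem_filter.2 ⟨hs, hs0⟩⟩
  -- The orders of vanishing at `β`, multiplicity plus `s`, are pairwise distinct because the `s`
  -- differ by non-integers. Dividing by the lowest power leaves only the term of `t` in the limit.
  obtain ⟨t, ht, hmin⟩ := S'.exists_min_image (fun s => ((H s).rootMultiplicity β : ℝ) + s) hne'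
  have hG : ∀ s, ∃ G : ℝ[X], H s = (X - C β) ^ (H s).rootMultiplicity β * G ∧
      (H s ≠ 0 → G.eval β ≠ 0) := fun s => by
    by_cases h0 : H s = 0
    · exact ⟨0, by simp [h0], fun h => (h h0).elim⟩
    · obtain ⟨G, hG, hnd⟩ := exists_eq_pow_rootMultiplicity_mul_and_not_dvd (H s) h0 β
      exact ⟨G, hG, fun _ hr => hnd (dvd_iff_isRoot.2 hr)⟩
  choose G hG hGβ using hG
  set μ : ℝ := (H t).rootMultiplicity β + t with hμ
  set ν : ℝ → ℝ := fun s => ((H s).rootMultiplicity β : ℝ) + s - μ with hν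
  have hterm : ∀ s, ∀ x, β < x → (H s).eval x * Y.eval x ^ s =
      (x - β) ^ μ * ((x - β) ^ ν s * ((G s).eval x * Z.eval x ^ s)) := fun s x hx => by
    have hx0 : 0 < x - β := sub_pos.2 hx
    have e1 : (H s).eval x = (x - β) ^ (((H s).rootMultiplicity β : ℕ) : ℝ) * (G s).eval x := by
      conv_lhs => rw [hG s]
      simp [Real.rpow_natCast]
    have e2 : Y.eval x = (x - β) * Z.eval x := by rw [hZ]; simp
    rw [e1, e2, Real.mul_rpow hx0.le (hZpos x hx).le, ← mul_assoc ((x - β) ^ μ),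
      ← Real.rpow_add hx0]
    rw [show μ + ν s = ((H s).rootMultiplicity β : ℝ) + s by simp [hν], Real.rpow_add hx0]
    ring
  have hzero : ∀ x, β < x → ∑ s ∈ S', (x - β) ^ ν s * ((G s).eval x * Z.eval x ^ s) = 0 := by
    intro x hx
    have h1 := h x hx
    rw [← Finset.sum_subset (Finset.filter_subset (fun s => H s ≠ 0) S) (fun s hs hs' => by
      have : H s = 0 := by
        by_contra h0; exact hs' (Finset.mem_filter.2 ⟨hs, h0⟩)
      simp [this]), Finset.sum_congr rfl fun s _ => hterm s x hx, ← Finset.mul_sum] at h1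
    exact (mul_eq_zero.1 h1).resolve_left (Real.rpow_pos_of_pos (sub_pos.2 hx) _).ne'
  have hlim : ∀ s ∈ S', Tendsto (fun x => (x - β) ^ ν s * ((G s).eval x * Z.eval x ^ s)) (𝓝[>] β)
      (𝓝 (if s = t then (G t).eval β * Z.eval β ^ t else 0)) := by
    intro s hs
    have hl2 : Tendsto (fun x => (G s).eval x * Z.eval x ^ s) (𝓝[>] β)
        (𝓝 ((G s).eval β * Z.eval β ^ s)) :=
      ((G s).continuous.continuousAt.mono_left nhdsWithin_le_nhds).mul
        (hlimZ.rpow_const (Or.inl hZβ))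
    by_cases hst : s = t
    · subst hst
      simpa [hν, hμ] using hl2
    · have hνpos : 0 < ν s := by
        have hle := hmin s hs
        refine lt_of_le_of_ne (by simp only [hν, hμ]; linarith) fun h0 => hst ?_
        have hs1 := hS s (Finset.mem_filter.1 hs).1
        have ht1 := hS t (Finset.mem_filter.1 ht).1
        simp only [hν, hμ] at h0
        have h3 : (((H s).rootMultiplicity β : ℤ) : ℝ) - (((H t).rootMultiplicity β : ℤ) : ℝ)
            = t - s := by push_cast; linarith
        have h4 : ((H s).rootMultiplicity β : ℤ) - ((H t).rootMultiplicity β : ℤ) = 0 := by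
          have l1 : ((H s).rootMultiplicity β : ℤ) - ((H t).rootMultiplicity β : ℤ) < 1 := by
            have : ((((H s).rootMultiplicity β : ℤ) - ((H t).rootMultiplicity β : ℤ) : ℤ) : ℝ)
              < 1 := by push_cast at h3 ⊢; linarith
            exact_mod_cast this
          have l2 : -1 < ((H s).rootMultiplicity β : ℤ) - ((H t).rootMultiplicity β : ℤ) := by
            have : (-1 : ℝ) <
              ((((H s).rootMultiplicity β : ℤ) - ((H t).rootMultiplicity β : ℤ) : ℤ) : ℝ) := by
              push_cast at h3 ⊢; linarith
            exact_mod_cast this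
          omega
        have h5 : ((((H s).rootMultiplicity β : ℤ) - ((H t).rootMultiplicity β : ℤ) : ℤ) : ℝ)
            = 0 := by rw [h4]; simp
        push_cast at h3 h5
        linarith
      rw [if_neg hst]
      have hl1 : Tendsto (fun x => (x - β) ^ ν s) (𝓝[>] β) (𝓝 0) := by
        have : Tendsto (fun x : ℝ => x - β) (𝓝[>] β) (𝓝 0) := by
          have : Tendsto (fun x : ℝ => x - β) (𝓝 β) (𝓝 (β - β)) :=
            (continuous_id.sub continuous_const).tendsto β
          rw [sub_self] at this
          exact this.mono_left nhdsWithin_le_nhds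
        have h2 := this.rpow_const (p := ν s) (Or.inr hνpos.le)
        rwa [Real.zero_rpow hνpos.ne'] at h2
      simpa using hl1.mul hl2
  have hl := tendsto_finsetSum S' hlim
  rw [Finset.sum_ite_eq' S', if_pos ht] at hl
  have hl0 : Tendsto (fun x => ∑ s ∈ S', (x - β) ^ ν s * ((G s).eval x * Z.eval x ^ s)) (𝓝[>] β)
      (𝓝 0) := tendsto_const_nhds.congr' (eventually_nhdsWithin_of_forall fun x hx =>
        (hzero x hx).symm)
  have := tendsto_nhds_unique hl hl0
  exact mul_ne_zero (hGβ t (Finset.mem_filter.1 ht).2) (Real.rpow_pos_of_pos hZβpos t).ne' this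

theorem coeff_mul_reflect_self {p : ℤ[X]} (D : ℕ) :
    (p * p.reflect D).coeff D = ∑ i ∈ Finset.range (D + 1), p.coeff i ^ 2 := by
  rw [coeff_mul, Finset.Nat.sum_antidiagonal_eq_sum_range_succ_mk]
  refine Finset.sum_congr rfl fun i hi => ?_
  have hi' : i ≤ D := Nat.lt_succ_iff.1 (Finset.mem_range.1 hi)
  simp only
  rw [coeff_reflect, revAt_le (Nat.sub_le _ _), Nat.sub_sub_self hi', sq]

/-- Nonzero integers have square at least `1`. With `coeff_mul_reflect_self`, the autocorrelation
bounds the number of terms. -/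
theorem card_support_le_sum_sq {p : ℤ[X]} {D : ℕ} (hp : p.natDegree ≤ D) :
    (p.support.card : ℤ) ≤ ∑ i ∈ Finset.range (D + 1), p.coeff i ^ 2 := by
  have h1 : (p.support.card : ℤ) ≤ ∑ i ∈ p.support, p.coeff i ^ 2 := by
    rw [Finset.cast_card]
    refine Finset.sum_le_sum fun i hi => ?_
    have := mem_support_iff.1 hi
    have : 0 < p.coeff i ^ 2 := by positivity
    omega
  refine h1.trans (Finset.sum_le_sum_of_subset_of_nonneg (fun i hi => ?_) fun _ _ _ => sq_nonneg _)
  exact Finset.mem_range.2 (Nat.lt_succ_iff.2 ((le_natDegree_of_mem_supp i hi).trans hp))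

theorem sum_sq_coeff_X_pow_mul_sub_one (g : ℤ[X]) {n : ℕ} (hn : 1 ≤ n) (l : ℕ) :
    ∑ i ∈ Finset.range (n + l + 1), (X ^ n * g - 1 : ℤ[X]).coeff i ^ 2 =
      1 + ∑ j ∈ Finset.range (l + 1), g.coeff j ^ 2 := by
  rw [add_assoc, Finset.sum_range_add]
  congr 1
  · rw [Finset.sum_eq_single_of_mem 0 (Finset.mem_range.2 hn)]
    · simp [show 0 ≠ n by omega]
    · intro i hi h0
      have := Finset.mem_range.1 hi
      simp [coeff_X_pow_mul', coeff_one, h0, this]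
  · refine Finset.sum_congr rfl fun j _ => ?_
    simp [coeff_X_pow_mul', coeff_one, show n ≠ 0 by omega]

theorem aeval_eq_sum_of_support_subset {p : ℤ[X]} {E : Finset ℕ} (h : p.support ⊆ E) (x : ℝ) :
    aeval x p = ∑ e ∈ E, p.coeff e * x ^ e := by
  rw [aeval_def, eval₂_eq_sum, sum_def]
  refine Finset.sum_subset h fun e _ he => by simp [notMem_support_iff.1 he]

theorem analyticAt_aeval_inv_rpow (p : ℤ[X]) (c : ℝ) {x : ℝ} (hx : 0 < aeval x p) :
    AnalyticAt ℝ (fun x => (aeval x p)⁻¹ ^ c) x := by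
  have h1 : AnalyticAt ℝ (fun x : ℝ => aeval x p) x := analyticAt_id.aeval_polynomial p
  have h2 : AnalyticAt ℝ (fun x : ℝ => Real.exp (Real.log (aeval x p)⁻¹ * c)) x :=
    (((h1.inv hx.ne').log (inv_pos.2 hx)).mul analyticAt_const).rexp
  refine h2.congr ?_
  have : ∀ᶠ y in 𝓝 x, 0 < aeval y p := h1.continuousAt.eventually (eventually_gt_nhds hx)
  filter_upwards [this] with y hy
  rw [Real.rpow_def_of_pos (inv_pos.2 hy)]

/-- If a polynomial `w`, lifted to two variables by a weight with values in `[0, 1]`, vanishes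
along the curve `y * Y(x) = 1`, then `Y - 1` divides `w`. -/
theorem dvd_of_sum_mul_rpow_eq_zero {w Y : ℤ[X]} {E : Finset ℕ} (hw : w.support ⊆ E) {A : ℕ → ℝ}
    (hA : ∀ e ∈ E, 0 ≤ A e ∧ A e ≤ 1) {β : ℝ} (hY : aeval β Y = 0)
    (hY' : aeval β (derivative Y) ≠ 0) (hpos : ∀ x, β < x → 0 < aeval x Y)
    (h : ∀ x, β < x → ∑ e ∈ E, w.coeff e * x ^ e * (aeval x Y)⁻¹ ^ A e = 0) : Y - 1 ∣ w := by
  classical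
  set U : ℤ[X] := ∑ e ∈ E with A e = 0, monomial e (w.coeff e) with hU
  set V : ℤ[X] := ∑ e ∈ E with A e ≠ 0, monomial e (w.coeff e) with hV
  have hwUV : w = U + V := by
    rw [hU, hV, Finset.sum_filter_add_sum_filter_not]
    conv_lhs => rw [w.as_sum_support]
    exact Finset.sum_subset hw fun e _ he => by simp [notMem_support_iff.1 he]
  -- Multiplying the relation by `Y` turns exponents `-A e` into `1 - A e`. This lies in `[0, 1)`
  -- unless `A e = 0`; those terms contribute the polynomial `Y * U` to the exponent `0`.
  set S : Finset ℝ := insert 0 ((E.filter fun e => A e ≠ 0).image fun e => 1 - A e) with hS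
  set H : ℝ → ℤ[X] := fun s => (∑ e ∈ E with A e ≠ 0, if 1 - A e = s then
    monomial e (w.coeff e) else 0) + if s = 0 then Y * U else 0 with hH
  have hmem : ∀ e ∈ E.filter fun e => A e ≠ 0, 1 - A e ∈ S := fun e he =>
    Finset.mem_insert_of_mem (Finset.mem_image_of_mem _ he)
  set φ := Int.castRingHom ℝ
  have hev : ∀ (p : ℤ[X]) (x : ℝ), (p.map φ).eval x = aeval x p := fun p x => by
    rw [eval_map, aeval_def]; rfl
  have hzero : ∀ s ∈ S, (H s).map φ = 0 := by
    refine eq_zero_of_sum_mul_rpow_eq_zero (Y := Y.map φ) (β := β) ?_ ?_ ?_ ?_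
      (H := fun s => (H s).map φ) ?_
    · rw [IsRoot.def, hev, hY]
    · rwa [derivative_map, hev]
    · intro x hx; rw [hev]; exact hpos x hx
    · intro s hs
      rcases Finset.mem_insert.1 hs with rfl | hs
      · simp
      · obtain ⟨e, he, rfl⟩ := Finset.mem_image.1 hs
        obtain ⟨he, h0⟩ := Finset.mem_filter.1 he
        obtain ⟨h1, h2⟩ := hA e he
        exact ⟨by linarith, by linarith [lt_of_le_of_ne h1 (Ne.symm h0)]⟩
    · intro x hx
      simp only [hev]
      have hYx := hpos x hx
      have e1 : ∀ s, aeval x (H s) * (aeval x Y : ℝ) ^ s = (∑ e ∈ E with A e ≠ 0,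
          if 1 - A e = s then (w.coeff e : ℝ) * x ^ e * (aeval x Y) ^ (1 - A e) else 0) +
          if s = 0 then aeval x Y * aeval x U else 0 := fun s => by
        rw [hH]
        simp only [map_add, map_sum, add_mul, Finset.sum_mul]
        congr 1
        · refine Finset.sum_congr rfl fun e _ => ?_
          split_ifs with hs
          · rw [hs, aeval_monomial]; simp
          · simp
        · split_ifs with hs
          · rw [hs]; simp
          · simp
      rw [Finset.sum_congr rfl fun s _ => e1 s, Finset.sum_add_distrib, Finset.sum_comm,
        Finset.sum_ite_eq' S, if_pos (Finset.mem_insert_self _ _)]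
      have e2 : ∀ e ∈ E.filter fun e => A e ≠ 0, (∑ s ∈ S, if 1 - A e = s then
          (w.coeff e : ℝ) * x ^ e * (aeval x Y) ^ (1 - A e) else 0) =
          aeval x Y * (w.coeff e * x ^ e * (aeval x Y)⁻¹ ^ A e) := fun e he => by
        rw [Finset.sum_ite_eq S, if_pos (hmem e he), Real.rpow_sub hYx, Real.rpow_one,
          Real.inv_rpow hYx.le]
        ring
      have e3 : aeval x U = ∑ e ∈ E with A e = 0, w.coeff e * x ^ e * (aeval x Y)⁻¹ ^ A e := by
        rw [hU, map_sum]
        refine Finset.sum_congr rfl fun e he => ?_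
        rw [(Finset.mem_filter.1 he).2, aeval_monomial]; simp
      rw [Finset.sum_congr rfl e2, ← Finset.mul_sum, e3, ← mul_add, add_comm,
        Finset.sum_filter_add_sum_filter_not, h x hx, mul_zero]
  have hinj : Function.Injective (Polynomial.map φ) := map_injective φ Int.cast_injective
  -- All `H s` vanish, so `V = -Y * U` and `w = U + V = -(Y - 1) * U`.
  have hsum : ∑ s ∈ S, H s = V + Y * U := by
    simp only [hH]
    rw [Finset.sum_add_distrib, Finset.sum_comm, Finset.sum_ite_eq' S,
      if_pos (Finset.mem_insert_self _ _), hV]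
    congr 1
    refine Finset.sum_congr rfl fun e he => ?_
    rw [Finset.sum_ite_eq S, if_pos (hmem e he)]
  rw [Finset.sum_eq_zero fun s hs => hinj ((hzero s hs).trans (Polynomial.map_zero φ).symm)] at hsum
  exact ⟨-U, by rw [hwUV]; linear_combination -hsum⟩

/-- On the curve `y * Y(x) = 1` the lift of `f = Y - 1` vanishes, hence so does the product of the
two lifts of `w`. By analyticity one factor vanishes identically: the first gives divisibility, the
second would give `w(b⁻¹) = 0`, since `Y(b) = 1`. -/
theorem exists_forall_dvd_mul_reflect {g : ℤ[X]} (hg : g.Monic) {β : ℝ} (hβ : 0 < β)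
    (hroot : aeval β g = 0) (hsimple : aeval β (derivative g) ≠ 0)
    (hpos : ∀ x, β < x → 0 < aeval x g) :
    ∃ N, ∀ n ≥ N, ∀ m q : ℤ[X], m * q = X ^ n * g - 1 → ∀ b : ℝ, β < b →
      aeval b (X ^ n * g - 1 : ℤ[X]) = 0 → aeval b⁻¹ (m * q.reflect q.natDegree) ≠ 0 →
      X ^ n * g - 1 ∣ m * q.reflect q.natDegree := by
  classical
  set l := g.natDegree
  -- The sum of squared coefficients of `f`, independent of `n`; it bounds the supports of both `f`
  -- and `w`.
  set M : ℤ := 1 + ∑ j ∈ Finset.range (l + 1), g.coeff j ^ 2 with hM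
  obtain ⟨N, hN⟩ := exists_additive_weight (2 * M.toNat) l
  refine ⟨max N 1, fun n hn m q hmq b hb hfb hwb => ?_⟩
  have hnN : N ≤ n := (le_max_left _ _).trans hn
  have hn1 : 1 ≤ n := (le_max_right _ _).trans hn
  set f : ℤ[X] := X ^ n * g - 1 with hf
  set w : ℤ[X] := m * q.reflect q.natDegree with hw
  have hfdeg : f.natDegree = n + l := by
    rw [hf, ← C_1, natDegree_sub_C, (monic_X_pow n).natDegree_mul hg, natDegree_X_pow]
  have hf0 : f.coeff 0 = -1 := by
    simp [hf, show 0 ≠ n by omega]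
  have hfne : f ≠ 0 := by rintro h; simp [h] at hf0
  have hm0 : m ≠ 0 := by rintro rfl; exact hfne (by rw [← hmq, zero_mul])
  have hq0 : q ≠ 0 := by rintro rfl; exact hfne (by rw [← hmq, mul_zero])
  have hdeg : m.natDegree + q.natDegree = n + l := by rw [← natDegree_mul hm0 hq0, hmq, hfdeg]
  have hqr : (q.reflect q.natDegree).natDegree ≤ q.natDegree := by
    simpa using natDegree_reflect_le (N := q.natDegree) (p := q)
  have hwdeg : w.natDegree ≤ n + l := by
    have : w.natDegree ≤ _ := natDegree_mul_le (p := m) (q := q.reflect q.natDegree)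
    omega
  have hauto : w * w.reflect (n + l) = f * f.reflect (n + l) := by
    rw [hw, ← hmq, ← hdeg, reflect_mul m _ le_rfl hqr, reflect_mul m q le_rfl le_rfl,
      reflect_reflect]
    ring
  have hfM : ∑ i ∈ Finset.range (n + l + 1), f.coeff i ^ 2 = M :=
    sum_sq_coeff_X_pow_mul_sub_one g hn1 l
  have hfcard := card_support_le_sum_sq hfdeg.le
  have hwcard := card_support_le_sum_sq hwdeg
  rw [← coeff_mul_reflect_self, hauto, coeff_mul_reflect_self] at hwcard
  rw [hfM] at hfcard hwcard
  set E := w.support ∪ f.support with hE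
  have hEw : w.support ⊆ E := Finset.subset_union_left
  have hEf : f.support ⊆ E := Finset.subset_union_right
  have hEcard : E.card ≤ 2 * M.toNat := by
    have : E.card ≤ _ := Finset.card_union_le w.support f.support
    omega
  have hEle : ∀ e ∈ E, e ≤ n + l := fun e he => by
    rcases Finset.mem_union.1 he with he | he
    · exact (le_natDegree_of_mem_supp e he).trans hwdeg
    · exact (le_natDegree_of_mem_supp e he).trans hfdeg.le
  have h0E : 0 ∈ E := hEf (mem_support_iff.2 (by rw [hf0]; decide))
  obtain ⟨A, hA01, hA0, hA1, hA⟩ := hN n hnN E hEcard hEle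
  set Y : ℤ[X] := X ^ n * g with hY
  have hYpos : ∀ x, β < x → 0 < aeval x Y := fun x hx => by
    have := hpos x hx
    have : 0 < x := hβ.trans hx
    simp only [hY, map_mul, map_pow, aeval_X]; positivity
  have hfsum : ∀ x, β < x → ∑ e ∈ E, f.coeff e * x ^ e * (aeval x Y)⁻¹ ^ A e = 0 := by
    intro x hx
    have hYx := hYpos x hx
    have hterm : ∀ e ∈ E, f.coeff e * x ^ e * (aeval x Y)⁻¹ ^ A e =
        (aeval x Y)⁻¹ * (f.coeff e * x ^ e) + if e = 0 then (aeval x Y)⁻¹ - 1 else 0 := by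
      intro e he
      split_ifs with h0
      · subst h0
        rw [hA0 h0E, hf0]; simp; ring
      · by_cases hne : n ≤ e
        · rw [hA1 e he hne]; simp; ring
        · have : f.coeff e = 0 := by
            simp [hf, hY, coeff_X_pow_mul', hne, coeff_one, h0]
          simp [this]
    rw [Finset.sum_congr rfl hterm, Finset.sum_add_distrib, ← Finset.mul_sum,
      ← aeval_eq_sum_of_support_subset hEf, Finset.sum_ite_eq' E, if_pos h0E, hf, map_sub, map_one]
    field_simp
    ring
  have hprod : ∀ x ∈ Set.Ioi β, (∑ e ∈ E, w.coeff e * x ^ e * (aeval x Y)⁻¹ ^ A e) *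
      (∑ e ∈ E, w.coeff e * x⁻¹ ^ e * (aeval x Y)⁻¹ ^ (-A e)) = 0 := fun x hx => by
    rw [weighted_autocorrelation_eq hEle hEw hEf hauto hA (hβ.trans hx) (inv_pos.2 (hYpos x hx)),
      hfsum x hx, zero_mul]
  have han1 : AnalyticOnNhd ℝ (fun x : ℝ => ∑ e ∈ E, w.coeff e * x ^ e * (aeval x Y)⁻¹ ^ A e)
      (Set.Ioi β) := fun x hx => Finset.analyticAt_fun_sum _ fun e _ =>
    (analyticAt_const.mul (analyticAt_id.pow e)).mul (analyticAt_aeval_inv_rpow Y _ (hYpos x hx))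
  have han2 : AnalyticOnNhd ℝ (fun x : ℝ => ∑ e ∈ E, w.coeff e * x⁻¹ ^ e * (aeval x Y)⁻¹ ^ (-A e))
      (Set.Ioi β) := fun x hx => Finset.analyticAt_fun_sum _ fun e _ =>
    (analyticAt_const.mul ((analyticAt_id.inv (hβ.trans hx).ne').pow e)).mul
      (analyticAt_aeval_inv_rpow Y _ (hYpos x hx))
  rcases han1.eq_zero_or_eq_zero_of_mul_eq_zero han2 hprod isPreconnected_Ioi with h | h
  · refine dvd_of_sum_mul_rpow_eq_zero hEw hA01 ?_ ?_ hYpos h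
    · simp [hroot]
    · simp only [derivative_mul, map_add, map_mul, hroot, mul_zero, zero_add, map_pow, aeval_X]
      exact mul_ne_zero (pow_pos hβ n).ne' hsimple
  · refine (hwb ?_).elim
    have hYb : aeval b Y = 1 := by
      rw [hf, map_sub, map_one] at hfb; linarith
    have := h b hb
    simp only [hYb, inv_one, Real.one_rpow, mul_one] at this
    rwa [aeval_eq_sum_of_support_subset hEw]

/-! ### Digit polynomials and their positive root -/

/-- Monic integer polynomials whose other coefficients are nonpositive. -/
structure IsDigitPoly (p : ℤ[X]) : Prop where
  monic : p.Monic
  coeff_nonpos : ∀ i < p.natDegree, p.coeff i ≤ 0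

theorem isDigitPoly_one : IsDigitPoly 1 := ⟨monic_one, by simp⟩

namespace IsDigitPoly

variable {p : ℤ[X]}

theorem natDegree_X_pow_mul_sub (hp : IsDigitPoly p) (n : ℕ) (c : ℤ) :
    (X ^ n * p - C c).natDegree = n + p.natDegree := by
  rw [natDegree_sub_C, (monic_X_pow n).natDegree_mul hp.monic, natDegree_X_pow]

theorem X_pow_mul_sub (hp : IsDigitPoly p) {n : ℕ} (hn : 1 ≤ n) {c : ℤ} (hc : 0 ≤ c) :
    IsDigitPoly (X ^ n * p - C c) := by
  have hd := hp.natDegree_X_pow_mul_sub n c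
  refine ⟨?_, fun i hi => ?_⟩
  · rw [Monic, leadingCoeff, hd, coeff_sub, coeff_C_of_ne_zero (by omega), sub_zero, add_comm,
      coeff_X_pow_mul]
    exact hp.monic
  · rw [hd] at hi
    rw [coeff_sub, coeff_X_pow_mul', coeff_C]
    have h1 : (if n ≤ i then p.coeff (i - n) else 0) ≤ 0 := by
      split_ifs with h
      · exact hp.coeff_nonpos _ (by omega)
      · exact le_rfl
    have h2 : 0 ≤ if i = 0 then c else 0 := by split_ifs <;> simp [hc]
    linarith

theorem coeff_zero_X_pow_mul_sub {n : ℕ} (hn : 1 ≤ n) (c : ℤ) :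
    (X ^ n * p - C c).coeff 0 = -c := by
  simp [show 0 ≠ n by omega]

theorem natDegree_pos (hp : IsDigitPoly p) (h0 : p.coeff 0 < 0) : 0 < p.natDegree := by
  by_contra h
  have h : p.natDegree = 0 := by omega
  have := hp.monic.coeff_natDegree
  rw [h] at this
  omega

/-- With `d` the degree, `p(x) / x ^ d` is strictly increasing on `(0, ∞)`, as all its non-constant
terms have nonpositive coefficients and the last a negative one. -/
theorem aeval_pos_of_lt (hp : IsDigitPoly p) (h0 : p.coeff 0 < 0) {x y : ℝ} (hx : 0 < x)
    (hxy : x < y) (h : 0 ≤ aeval x p) : 0 < aeval y p := by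
  set d := p.natDegree with hd
  have hd0 : 0 < d := hp.natDegree_pos h0
  have hy : 0 < y := hx.trans hxy
  have key : 0 < x ^ d * aeval y p - y ^ d * aeval x p := by
    rw [aeval_eq_sum_range, aeval_eq_sum_range, Finset.mul_sum, Finset.mul_sum,
      ← Finset.sum_sub_distrib]
    have hterm : ∀ k, x ^ d * p.coeff k • y ^ k - y ^ d * p.coeff k • x ^ k =
        -(p.coeff k : ℝ) * (y ^ d * x ^ k - x ^ d * y ^ k) := fun k => by
      rw [zsmul_eq_mul, zsmul_eq_mul]; ring
    simp only [hterm]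
    have hle : ∀ k ≤ d, 0 ≤ y ^ d * x ^ k - x ^ d * y ^ k := fun k hk => by
      obtain ⟨j, hj⟩ := Nat.exists_eq_add_of_le hk
      rw [hj, pow_add, pow_add]
      have : x ^ j ≤ y ^ j := by gcongr
      have h2 : 0 < y ^ k * x ^ k := by positivity
      nlinarith
    refine Finset.sum_pos' (fun k hk => ?_) ⟨0, by simp, ?_⟩
    · have hk' : k ≤ d := Nat.lt_succ_iff.1 (Finset.mem_range.1 hk)
      rcases hk'.eq_or_lt with rfl | hk'
      · rw [mul_comm (y ^ _), sub_self, mul_zero]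
      · have : (p.coeff k : ℝ) ≤ 0 := by exact_mod_cast hp.coeff_nonpos k hk'
        exact mul_nonneg (by linarith) (hle k hk'.le)
    · have h1 : (p.coeff 0 : ℝ) < 0 := by exact_mod_cast h0
      have : x ^ d < y ^ d := pow_lt_pow_left₀ hxy hx.le hd0.ne'
      simp only [pow_zero, mul_one]
      exact mul_pos (by linarith) (by linarith)
  have h1 : 0 ≤ y ^ d * aeval x p := mul_nonneg (by positivity) h
  exact pos_of_mul_pos_right (by linarith : 0 < x ^ d * aeval y p) (by positivity)

/-- The polynomial `X * p' - d * p` has coefficients `(k - d) * p_k ≥ 0`, positive at `k = 0`. -/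
theorem aeval_derivative_pos (hp : IsDigitPoly p) (h0 : p.coeff 0 < 0) {x : ℝ} (hx : 0 < x)
    (h : aeval x p = 0) : 0 < aeval x (derivative p) := by
  set d := p.natDegree with hd
  have hd0 : 0 < d := hp.natDegree_pos h0
  set s : ℤ[X] := X * derivative p - C (d : ℤ) * p with hs
  have hcoeff : ∀ k, s.coeff k = ((k : ℤ) - d) * p.coeff k := fun k => by
    rw [hs, coeff_sub, coeff_C_mul]
    cases k with
    | zero => simp
    | succ k => rw [coeff_X_mul, coeff_derivative]; push_cast; ring
  have hsd : s.natDegree < d + 1 := by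
    refine Nat.lt_succ_iff.2 (natDegree_le_iff_coeff_eq_zero.2 fun k hk => ?_)
    rw [hcoeff, coeff_eq_zero_of_natDegree_lt hk, mul_zero]
  have hpos : 0 < aeval x s := by
    rw [aeval_eq_sum_range' hsd]
    refine Finset.sum_pos' (fun k hk => ?_) ⟨0, by simp, ?_⟩
    · rw [hcoeff, zsmul_eq_mul]
      refine mul_nonneg ?_ (by positivity)
      have hk' : k ≤ d := Nat.lt_succ_iff.1 (Finset.mem_range.1 hk)
      rcases hk'.eq_or_lt with rfl | hk'
      · simp
      · have h1 := hp.coeff_nonpos k hk'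
        have : 0 ≤ ((k : ℤ) - d) * p.coeff k := mul_nonneg_of_nonpos_of_nonpos (by omega) h1
        exact_mod_cast this
    · rw [hcoeff, zsmul_eq_mul, pow_zero, mul_one]
      have : 0 < (((0 : ℕ) : ℤ) - d) * p.coeff 0 :=
        mul_pos_of_neg_of_neg (by push_cast; omega) h0
      exact_mod_cast this
  rw [hs, map_sub, map_mul, map_mul, h, mul_zero, sub_zero, aeval_X] at hpos
  exact pos_of_mul_pos_right hpos hx.le

theorem exists_aeval_eq_zero (hp : IsDigitPoly p) (h0 : p.coeff 0 < 0) :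
    ∃ x : ℝ, 0 < x ∧ aeval x p = 0 := by
  have hm := hp.monic.map (Int.castRingHom ℝ)
  have hdeg : (p.map (Int.castRingHom ℝ)).natDegree = p.natDegree := hp.monic.natDegree_map _
  have ht := tendsto_atTop_of_leadingCoeff_nonneg (p.map (Int.castRingHom ℝ))
    (natDegree_pos_iff_degree_pos.1 (by rw [hdeg]; exact hp.natDegree_pos h0))
    (by rw [hm.leadingCoeff]; exact zero_le_one)
  obtain ⟨y, hy1, hy0⟩ := ((ht.eventually_gt_atTop 0).and (eventually_gt_atTop 0)).exists
  have hev : (p.map (Int.castRingHom ℝ)).eval y = aeval y p := by rw [eval_map, aeval_def]; rfl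
  rw [hev] at hy1
  have h00 : aeval (0 : ℝ) p < 0 := by
    rw [← coeff_zero_eq_aeval_zero']; simpa using h0
  obtain ⟨x, hx, hx0⟩ := intermediate_value_Ioo hy0.le p.continuous_aeval.continuousOn ⟨h00, hy1⟩
  exact ⟨x, hx.1, hx0⟩

end IsDigitPoly

/-! ### A criterion for not being a Yrrap number -/

theorem exists_aeval_eq_zero_lt_neg_one {p : ℤ[X]} (hp : p.Monic) (he : Even p.natDegree)
    (h : aeval (-1 : ℝ) p < 0) : ∃ x : ℝ, x < -1 ∧ aeval x p = 0 := by
  have hd : 0 < p.natDegree := by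
    by_contra h0
    have := eq_one_of_monic_natDegree_zero hp (by omega)
    rw [this, map_one] at h
    linarith
  set s : ℝ[X] := (p.map (Int.castRingHom ℝ)).comp (-X) with hs
  have hdeg : (p.map (Int.castRingHom ℝ)).natDegree = p.natDegree := hp.natDegree_map _
  have hsd : s.natDegree = p.natDegree := by
    rw [hs, natDegree_comp, hdeg, natDegree_neg, natDegree_X, mul_one]
  have hsl : s.leadingCoeff = 1 := by
    rw [hs, leadingCoeff_comp (by simp), hdeg, (hp.map _).leadingCoeff, leadingCoeff_neg,
      leadingCoeff_X, he.neg_one_pow, mul_one]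
  have ht := tendsto_atTop_of_leadingCoeff_nonneg s
    (natDegree_pos_iff_degree_pos.1 (by rw [hsd]; exact hd)) (by rw [hsl]; exact zero_le_one)
  obtain ⟨y, hy1, hy0⟩ := ((ht.eventually_gt_atTop 0).and (eventually_gt_atTop 1)).exists
  have hev : s.eval y = aeval (-y) p := by
    rw [hs, eval_comp, eval_neg, eval_X, eval_map, aeval_def]; rfl
  rw [hev] at hy1
  obtain ⟨x, hx, hx0⟩ := intermediate_value_Ioo' (by linarith : -y ≤ -1)
    p.continuous_aeval.continuousOn ⟨h, hy1⟩
  exact ⟨x, hx.2, hx0⟩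

theorem notMem_yrrapNumbers_of_aeval_minpoly {b γ : ℝ} (hb : IsIntegral ℤ b) (hγ : γ ≤ -1)
    (h : aeval γ (minpoly ℤ b) = 0) : b ∉ yrrapNumbers := fun hY => by
  obtain ⟨p, hp, hne⟩ := exists_aeval_ne_zero_of_mem_yrrapNumbers hY
  exact hne γ hγ (aeval_eq_zero_of_dvd_aeval_eq_zero (minpoly.isIntegrallyClosed_dvd hb hp) h)

theorem aeval_inv_eq_zero_of_aeval_reflect {q : ℤ[X]} {x : ℝ} (hx : x ≠ 0)
    (h : aeval x (q.reflect q.natDegree) = 0) : aeval x⁻¹ q = 0 := by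
  have : Invertible x⁻¹ := invertibleOfNonzero (inv_ne_zero hx)
  have := eval₂_reflect_eq_zero_iff (algebraMap ℤ ℝ) x⁻¹ q.natDegree q le_rfl
  rw [invOf_eq_inv, inv_inv] at this
  exact this.1 h

theorem exists_forall_notMem_yrrapNumbers {g : ℤ[X]} (hg : IsDigitPoly g) (h0 : g.coeff 0 < 0)
    (he : Even g.natDegree) (hneg : ∀ x : ℝ, -1 ≤ x → x ≤ 0 → aeval x g ≤ 0) :
    ∃ N, ∀ n ≥ N, Even n → ∀ b : ℝ, 1 < b → aeval b (X ^ n * g - 1 : ℤ[X]) = 0 →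
      b ∉ yrrapNumbers := by
  obtain ⟨β, hβ, hroot⟩ := hg.exists_aeval_eq_zero h0
  obtain ⟨N, hN⟩ := exists_forall_dvd_mul_reflect hg.monic hβ hroot
    (hg.aeval_derivative_pos h0 hβ hroot).ne' fun x hx => hg.aeval_pos_of_lt h0 hβ hx hroot.ge
  refine ⟨max N 1, fun n hn hne b hb1 hb => ?_⟩
  have hnN : N ≤ n := (le_max_left _ _).trans hn
  have hn1 : 1 ≤ n := (le_max_right _ _).trans hn
  set f : ℤ[X] := X ^ n * g - 1 with hf
  have hfC : f = X ^ n * g - C 1 := by rw [hf, C_1]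
  have hfd : IsDigitPoly f := hfC ▸ hg.X_pow_mul_sub hn1 zero_le_one
  have hf0 : f.coeff 0 < 0 := by
    rw [hfC, IsDigitPoly.coeff_zero_X_pow_mul_sub hn1]; decide
  have hfe : Even f.natDegree := by
    rw [hfC, hg.natDegree_X_pow_mul_sub]; exact hne.add he
  have hfev : ∀ x : ℝ, aeval x f = x ^ n * aeval x g - 1 := fun x => by simp [hf]
  have hfneg : ∀ x : ℝ, -1 ≤ x → x ≤ 0 → aeval x f < 0 := fun x h1 h2 => by
    rw [hfev]
    have := mul_nonneg (hne.pow_nonneg x) (neg_nonneg.2 (hneg x h1 h2))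
    linarith
  obtain ⟨γ, hγ, hγ0⟩ := exists_aeval_eq_zero_lt_neg_one hfd.monic hfe
    (hfneg (-1) le_rfl (by norm_num))
  have hb0 : 0 < b := zero_lt_one.trans hb1
  have hint : IsIntegral ℤ b := ⟨f, hfd.monic, hb⟩
  obtain ⟨q, hq⟩ := minpoly.isIntegrallyClosed_dvd hint hb
  set m := minpoly ℤ b with hm
  have hfβ : aeval β f < 0 := by rw [hfev, hroot]; norm_num
  have hβb : β < b := by
    by_contra hle
    rcases (not_lt.1 hle).eq_or_lt with h | h
    · rw [← h, hb] at hfβ; exact lt_irrefl _ hfβ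
    · exact lt_asymm hfβ (hfd.aeval_pos_of_lt hf0 hb0 h hb.ge)
  have hfbinv : aeval b⁻¹ f ≠ 0 := fun h => by
    have hlt : b⁻¹ < b := (inv_lt_one_of_one_lt₀ hb1).trans hb1
    have := hfd.aeval_pos_of_lt hf0 (inv_pos.2 hb0) hlt h.ge
    rw [hb] at this
    exact lt_irrefl _ this
  -- The root `b` of `f` is simple, and `m` already accounts for it.
  have hqb : aeval b q ≠ 0 := fun h => by
    have := hfd.aeval_derivative_pos hf0 hb0 hb
    rw [hq, derivative_mul, map_add, map_mul, map_mul, h, hm, minpoly.aeval] at this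
    simp at this
  have hdvd := hN n hnN m q hq.symm b hβb hb (by
    rw [map_mul]
    refine mul_ne_zero (fun h => hfbinv ?_) fun h => hqb ?_
    · rw [hq, map_mul, h, zero_mul]
    · simpa using aeval_inv_eq_zero_of_aeval_reflect (inv_ne_zero hb0.ne') h)
  have hγw := aeval_eq_zero_of_dvd_aeval_eq_zero hdvd hγ0
  rw [map_mul] at hγw
  refine notMem_yrrapNumbers_of_aeval_minpoly hint hγ.le
    ((mul_eq_zero.1 hγw).resolve_right fun h => ?_)
  -- Otherwise `γ⁻¹ ∈ [-1, 0]` would be a root of `q`, hence of `f`, which is negative there.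
  have h1 := aeval_inv_eq_zero_of_aeval_reflect (by linarith : γ ≠ 0) h
  have h2 : aeval γ⁻¹ f = 0 := by rw [hq, map_mul, h1, mul_zero]
  have hγneg : γ < 0 := by linarith
  refine (hfneg γ⁻¹ ?_ (inv_lt_zero.2 hγneg).le).ne h2
  rw [← inv_neg_one]
  exact (inv_le_inv_of_neg (by norm_num) hγneg).2 hγ.le

/-! ### Density of the numbers whose orbit reaches zero -/

theorem floor_eq_of_forall_fract_ne_zero {v : ℝ → ℝ} {a c : ℝ} (hv : ContinuousOn v (Set.Icc a c))
    (h : ∀ b ∈ Set.Icc a c, Int.fract (v b) ≠ 0) {b : ℝ} (hb : b ∈ Set.Icc a c) :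
    ⌊v b⌋ = ⌊v a⌋ := by
  have ha : a ∈ Set.Icc a c := ⟨le_rfl, hb.1.trans hb.2⟩
  have key : ∀ s ∈ Set.Icc a c, ∀ t ∈ Set.Icc a c, ⌊v s⌋ ≤ ⌊v t⌋ := by
    intro s hs t ht
    by_contra hlt
    push Not at hlt
    have h1 : v t < ⌊v s⌋ := Int.floor_lt.1 hlt
    have h2 := isPreconnected_Icc.intermediate_value ht hs hv ⟨h1.le, Int.floor_le (v s)⟩
    obtain ⟨x, hx, hxv⟩ := h2
    exact h x hx (by rw [hxv, Int.fract_intCast])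
  exact le_antisymm (key b hb a ha) (key a ha b hb)

/-- The `β` for which the orbit of `1` reaches `0` are dense. -/
theorem exists_betaMap_iterate_eq_zero {a c : ℝ} (ha : 1 < a) (hac : a < c) :
    ∃ b ∈ Set.Icc a c, ∃ r, 1 ≤ r ∧ (betaMap b)^[r] 1 = 0 := by
  by_contra hcon
  push Not at hcon
  -- If no orbit reaches `0`, the digits cannot jump on `[a, c]`, so one polynomial sequence
  -- describes all orbits. Its difference at `c` and `a` grows like `c ^ k`, against the bound `1`.
  have key : ∀ k, ∀ b ∈ Set.Icc a c,
      (betaMap b)^[k] 1 = aeval b (hornerPoly 1 (betaDigit a) k) := by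
    intro k
    induction k with
    | zero => simp [hornerPoly]
    | succ k ih =>
      intro b hb
      have hfl := floor_eq_of_forall_fract_ne_zero (a := a) (c := c)
        (v := fun b => b * aeval b (hornerPoly 1 (betaDigit a) k))
        (continuous_id.mul (hornerPoly 1 (betaDigit a) k).continuous_aeval).continuousOn
        (fun b hb => by
          have := hcon b hb (k + 1) (by omega)
          rwa [Function.iterate_succ_apply', ih b hb] at this) hb
      simp only [aeval_hornerPoly_betaDigit] at hfl
      rw [Function.iterate_succ_apply', ih b hb, betaMap, Int.fract, hfl, aeval_hornerPoly_succ,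
        betaDigit]
      push_cast; ring
  have hc1 : 1 < c := ha.trans hac
  obtain ⟨k, hk⟩ := pow_unbounded_of_one_lt (1 / (c - a)) hc1
  have h1 := hornerPoly_betaDigit_sub_growth ha hac k
  rw [← key _ c ⟨hac.le, le_rfl⟩, ← key _ a ⟨le_rfl, hac.le⟩] at h1
  have h2 := betaMap_iterate_lt_one c k
  have h3 := betaMap_iterate_nonneg a (k + 1)
  rw [div_lt_iff₀ (by linarith)] at hk
  linarith

/-! ### Perturbed expansions: Parry numbers that are not Yrrap numbers -/

theorem betaMap_zero (β : ℝ) : betaMap β 0 = 0 := by simp [betaMap]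

theorem betaMap_iterate_eq_zero_of_le {β x : ℝ} {r k : ℕ} (h : (betaMap β)^[r] x = 0)
    (hrk : r ≤ k) : (betaMap β)^[k] x = 0 := by
  obtain ⟨j, rfl⟩ := Nat.exists_eq_add_of_le hrk
  rw [add_comm, Function.iterate_add_apply, h]
  exact Function.iterate_fixed (betaMap_zero β) j

theorem finite_forwardOrbit_of_iterate_eq_zero {β x : ℝ} {r : ℕ} (h : (betaMap β)^[r] x = 0) :
    (forwardOrbit (betaMap β) x).Finite := by
  refine ((Finset.range (r + 1)).finite_toSet.image fun n => (betaMap β)^[n] x).subset ?_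
  rintro _ ⟨n, rfl⟩
  by_cases hn : n ≤ r
  · exact ⟨n, by simpa [Nat.lt_succ_iff] using hn, rfl⟩
  · refine ⟨r, by simp, ?_⟩
    simp only
    rw [h, betaMap_iterate_eq_zero_of_le h (by omega)]

theorem betaMap_iterate_of_pow_mul_lt_one {β y : ℝ} (hβ : 1 ≤ β) (hy : 0 ≤ y) (k : ℕ)
    (h : β ^ k * y < 1) : (betaMap β)^[k] y = β ^ k * y := by
  induction k with
  | zero => simp
  | succ k ih =>
    have hle : β ^ k * y ≤ β ^ (k + 1) * y := by gcongr; simp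
    rw [Function.iterate_succ_apply', ih (hle.trans_lt h), betaMap, ← mul_assoc, ← pow_succ',
      Int.fract_eq_self.2 ⟨by positivity, h⟩]

theorem betaMap_iterate_eq_fract {β y : ℝ} (hβ : 1 ≤ β) (hy : 0 ≤ y) {k : ℕ} (hk : 1 ≤ k)
    (h : β ^ k * y < β) : (betaMap β)^[k] y = Int.fract (β ^ k * y) := by
  obtain ⟨j, rfl⟩ := Nat.exists_eq_add_of_le' hk
  have h1 : β ^ j * y < 1 := by
    rw [pow_succ', mul_assoc] at h
    exact (mul_lt_iff_lt_one_right (by linarith)).1 h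
  rw [Function.iterate_succ_apply', betaMap_iterate_of_pow_mul_lt_one hβ hy j h1, betaMap,
    ← mul_assoc, ← pow_succ']

/-- Smallness propagates backwards: if `β ^ M * y - 1` lies in `(0, ε]`, then `β ^ M * y ≤ 1 + ε <
β`, so `M` iterations of the transformation produce exactly this value, and `y ≤ ε` because `ε * β ^
M ≥ 2`. -/
theorem exists_betaMap_iterate_eq_iterate {β ε : ℝ} {M : ℕ} (hM : 1 ≤ M) (hε : ε < 1)
    (hεβ : 1 + ε < β) (hMβ : 2 ≤ ε * β ^ M) (K : ℕ) (y : ℝ)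
    (h0 : 0 < (fun y => β ^ M * y - 1)^[K] y) (h1 : (fun y => β ^ M * y - 1)^[K] y ≤ ε) :
    0 < y ∧ y ≤ ε ∧ ∃ k, (betaMap β)^[k] y = (fun y => β ^ M * y - 1)^[K] y := by
  induction K generalizing y with
  | zero => exact ⟨h0, h1, 0, rfl⟩
  | succ K ih =>
    rw [Function.iterate_succ_apply] at h0 h1 ⊢
    obtain ⟨hu0, hu1, k, hk⟩ := ih _ h0 h1
    set u := β ^ M * y - 1 with hu
    have hβ1 : 1 < β := by linarith
    have hP : 0 < β ^ M := by positivity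
    have hy0 : 0 < y := pos_of_mul_pos_right (by linarith : 0 < β ^ M * y) hP.le
    refine ⟨hy0, ?_, k + M, ?_⟩
    · by_contra hlt
      push Not at hlt
      have := mul_lt_mul_of_pos_left hlt hP
      linarith
    · have : Int.fract (β ^ M * y) = u := by
        rw [Int.fract_eq_iff]
        exact ⟨hu0.le, by linarith, 1, by rw [hu]; push_cast; ring⟩
      rw [Function.iterate_add_apply, betaMap_iterate_eq_fract hβ1.le hy0.le hM (by linarith),
        this, hk]

theorem isDigitPoly_hornerPoly {β : ℝ} (hβ : 0 ≤ β) (k : ℕ) :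
    IsDigitPoly (hornerPoly 1 (betaDigit β) k) ∧
      (hornerPoly 1 (betaDigit β) k).natDegree = k := by
  induction k with
  | zero => exact ⟨isDigitPoly_one, by simp [hornerPoly]⟩
  | succ k ih =>
    have : hornerPoly 1 (betaDigit β) (k + 1) =
        X ^ 1 * hornerPoly 1 (betaDigit β) k - C ⌊β * (betaMap β)^[k] 1⌋ := by
      simp [hornerPoly, betaDigit, sub_eq_add_neg]
    rw [this, ih.1.natDegree_X_pow_mul_sub, ih.2, add_comm]
    exact ⟨ih.1.X_pow_mul_sub le_rfl (Int.floor_nonneg.2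
      (mul_nonneg hβ (betaMap_iterate_nonneg β k))), rfl⟩

/-- The polynomial obtained from `p` by appending `K` times `M - 1` zeros and a one to the digits
of `p`. -/
noncomputable def appendOnes (M K : ℕ) (p : ℤ[X]) : ℤ[X] := (fun p => X ^ M * p - C 1)^[K] p

theorem appendOnes_succ (M K : ℕ) (p : ℤ[X]) :
    appendOnes M (K + 1) p = X ^ M * appendOnes M K p - C 1 :=
  Function.iterate_succ_apply' _ _ _

theorem aeval_appendOnes_succ (M K : ℕ) (p : ℤ[X]) (x : ℝ) :
    aeval x (appendOnes M (K + 1) p) = x ^ M * aeval x (appendOnes M K p) - 1 := by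
  simp [appendOnes_succ]

theorem aeval_appendOnes (M K : ℕ) (p : ℤ[X]) (x : ℝ) :
    aeval x (appendOnes M K p) = (fun y => x ^ M * y - 1)^[K] (aeval x p) := by
  induction K with
  | zero => rfl
  | succ K ih => rw [aeval_appendOnes_succ, ih, Function.iterate_succ_apply']

theorem isDigitPoly_appendOnes {M : ℕ} (hM : 1 ≤ M) {p : ℤ[X]} (hp : IsDigitPoly p) (K : ℕ) :
    IsDigitPoly (appendOnes M K p) ∧
      (appendOnes M K p).natDegree = K * M + p.natDegree := by
  induction K with
  | zero => simpa [appendOnes] using hp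
  | succ K ih =>
    rw [appendOnes_succ, ih.1.natDegree_X_pow_mul_sub, ih.2]
    exact ⟨ih.1.X_pow_mul_sub hM zero_le_one, by ring⟩

/-- As `0 ≤ x ^ M ≤ 1`, the `j`-th step lowers the bound to `(x ^ M) ^ j * (K - j)`. -/
theorem aeval_appendOnes_nonpos {M K : ℕ} (hM : Even M) {p : ℤ[X]}
    (hp : ∀ x : ℝ, -1 ≤ x → x ≤ 0 → aeval x p ≤ K) {x : ℝ} (h1 : -1 ≤ x) (h2 : x ≤ 0) :
    aeval x (appendOnes M K p) ≤ 0 := by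
  have hx0 : 0 ≤ x ^ M := hM.pow_nonneg x
  have hx1 : x ^ M ≤ 1 := by
    rw [← hM.neg_pow]; exact pow_le_one₀ (by linarith) (by linarith)
  have key : ∀ j, aeval x (appendOnes M j p) ≤ (x ^ M) ^ j * ((K : ℝ) - j) := fun j => by
    induction j with
    | zero => simpa [appendOnes] using hp x h1 h2
    | succ j ih =>
      rw [aeval_appendOnes_succ]
      have := mul_le_mul_of_nonneg_left ih hx0
      have hle : (x ^ M) ^ (j + 1) ≤ 1 := pow_le_one₀ hx0 hx1
      push_cast
      rw [pow_succ'] at hle ⊢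
      linarith
  simpa using key K

theorem aeval_appendOnes_ge {M : ℕ} {p : ℤ[X]} {x y : ℝ} (hx : 0 ≤ x) (hy : 1 + y ≤ x ^ M * y)
    (hp : y ≤ aeval x p) (K : ℕ) : y ≤ aeval x (appendOnes M K p) := by
  induction K with
  | zero => exact hp
  | succ K ih =>
    rw [aeval_appendOnes_succ]
    have := mul_le_mul_of_nonneg_left ih (pow_nonneg hx M)
    linarith

theorem aeval_appendOnes_nonpos_of_nonneg {M : ℕ} {p : ℤ[X]} {x : ℝ} (hx : 0 ≤ x)
    (hp : aeval x p ≤ 0) (K : ℕ) : aeval x (appendOnes M K p) ≤ 0 := by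
  induction K with
  | zero => exact hp
  | succ K ih =>
    rw [aeval_appendOnes_succ]
    have := mul_nonneg (pow_nonneg hx M) (neg_nonneg.2 ih)
    linarith

/-- To the right of `b₀` the polynomial values only increase, so they stay nonnegative; while they
remain below `1` the digits of `b₀` are also those of `b`. -/
theorem betaMap_iterate_eq_aeval_hornerPoly {b₀ b : ℝ} (hb₀ : 1 < b₀) (hb : b₀ < b) {r : ℕ}
    (h : ∀ k, k + 1 ≤ r → aeval b (hornerPoly 1 (betaDigit b₀) (k + 1)) < 1) :
    ∀ k ≤ r, (betaMap b)^[k] 1 = aeval b (hornerPoly 1 (betaDigit b₀) k) := by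
  intro k hk
  induction k with
  | zero => simp [hornerPoly]
  | succ k ih =>
    have h1 := h k hk
    have h2 := hornerPoly_betaDigit_sub_growth hb₀ hb k
    rw [aeval_hornerPoly_betaDigit] at h2
    have h3 := betaMap_iterate_nonneg b₀ (k + 1)
    have h4 : 0 ≤ b ^ k * (b - b₀) := mul_nonneg (pow_nonneg (by linarith) k) (by linarith)
    rw [Function.iterate_succ_apply', ih (by omega), betaMap, Int.fract_eq_iff]
    refine ⟨by linarith, h1, -betaDigit b₀ k, ?_⟩
    rw [aeval_hornerPoly_succ]
    push_cast; ring

theorem exists_mem_parryNumbers_notMem_yrrapNumbers {b₀ c : ℝ} (hb₀ : 1 < b₀) (hc : b₀ < c)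
    {r : ℕ} (hr : 1 ≤ r) (h : (betaMap b₀)^[r] 1 = 0) :
    ∃ b, b₀ < b ∧ b < c ∧ b ∈ parryNumbers ∩ yrrapNumbersᶜ := by
  -- The point `0` is fixed, so `r` may be doubled; an even degree is needed for the root below
  -- `-1`.
  wlog hre : Even r generalizing r
  · exact this (r := r + r) (by omega) (betaMap_iterate_eq_zero_of_le h (by omega)) ⟨r, rfl⟩
  set P := hornerPoly 1 (betaDigit b₀) with hP
  have hPr : aeval b₀ (P r) = 0 := by rw [hP, aeval_hornerPoly_betaDigit, h]
  obtain ⟨b₁, hb₁, hb₁c, hlt⟩ : ∃ b₁, b₀ < b₁ ∧ b₁ < c ∧ ∀ b, b₀ < b → b < b₁ →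
      ∀ k, k + 1 ≤ r → aeval b (P (k + 1)) < 1 := by
    have h1 : ∀ᶠ b in 𝓝 b₀, ∀ k ∈ Finset.range r, aeval b (P (k + 1)) < 1 := by
      rw [Filter.eventually_all_finset]
      intro k _
      refine (P (k + 1)).continuous_aeval.continuousAt.eventually (eventually_lt_nhds ?_)
      simp only [hP, aeval_hornerPoly_betaDigit]
      exact betaMap_iterate_lt_one b₀ k
    obtain ⟨δ, hδ, hball⟩ := Metric.eventually_nhds_iff.1 h1
    refine ⟨b₀ + min δ (c - b₀) / 2, ?_, ?_, ?_⟩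
    · have : 0 < min δ (c - b₀) := lt_min hδ (by linarith)
      linarith
    · have := min_le_right δ (c - b₀)
      linarith
    · intro b hb hb' k hk
      refine hball ?_ k (Finset.mem_range.2 (by omega))
      rw [Real.dist_eq, abs_of_pos (by linarith)]
      have := min_le_left δ (c - b₀)
      linarith
  set y₀ := aeval b₁ (P r) with hy₀
  have hy₀pos : 0 < y₀ := by
    obtain ⟨j, rfl⟩ := Nat.exists_eq_add_of_le' hr
    have h1 := hornerPoly_betaDigit_sub_growth hb₀ hb₁ j
    rw [← hP, hPr] at h1
    have : 0 < b₁ ^ j * (b₁ - b₀) := mul_pos (pow_pos (by linarith) j) (by linarith)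
    linarith
  -- The bound is `K + 1` so that at least one digit is appended, making the constant term of `g`
  -- equal to `-1`.
  obtain ⟨K, hK⟩ : ∃ K : ℕ, ∀ x : ℝ, -1 ≤ x → x ≤ 0 → aeval x (P r) ≤ ((K + 1 : ℕ) : ℝ) := by
    obtain ⟨C₀, hC₀⟩ := isCompact_Icc.exists_bound_of_continuousOn (s := Set.Icc (-1 : ℝ) 0)
      (P r).continuous_aeval.continuousOn
    obtain ⟨K, hK⟩ := exists_nat_ge C₀
    refine ⟨K, fun x h1 h2 => (le_abs_self _).trans ((hC₀ x ⟨h1, h2⟩).trans ?_)⟩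
    push_cast; linarith
  set ε : ℝ := min (1 / 2) ((b₀ - 1) / 2) with hε
  have hε0 : 0 < ε := lt_min (by norm_num) (by linarith)
  have hε1 : ε < 1 := (min_le_left _ _).trans_lt (by norm_num)
  have hεb : 1 + ε < b₀ := by linarith [min_le_right (1 / 2 : ℝ) ((b₀ - 1) / 2)]
  obtain ⟨M, hMe, hM1, hMε, hMy⟩ : ∃ M : ℕ, Even M ∧ 1 ≤ M ∧ 2 ≤ ε * b₀ ^ M ∧
      1 + y₀ ≤ b₀ ^ M * y₀ := by
    have ht := tendsto_pow_atTop_atTop_of_one_lt hb₀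
    have h1 := (ht.const_mul_atTop hε0).eventually_ge_atTop 2
    have h2 := (ht.atTop_mul_const hy₀pos).eventually_ge_atTop (1 + y₀)
    obtain ⟨N, hN⟩ := eventually_atTop.1 (h1.and h2)
    exact ⟨(N + 1) + (N + 1), ⟨_, rfl⟩, by omega, hN _ (by omega)⟩
  have hPd := isDigitPoly_hornerPoly (zero_le_one.trans hb₀.le) r
  rw [← hP] at hPd
  set g := appendOnes M (K + 1) (P r) with hg
  have hgd := isDigitPoly_appendOnes hM1 hPd.1 (K + 1)
  rw [← hg, hPd.2] at hgd
  have hg0 : g.coeff 0 < 0 := by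
    rw [hg, appendOnes_succ, IsDigitPoly.coeff_zero_X_pow_mul_sub hM1]; decide
  obtain ⟨N, hN⟩ := exists_forall_notMem_yrrapNumbers hgd.1 hg0
    (by rw [hgd.2]; exact (hMe.mul_left _).add hre)
    fun x h1 h2 => aeval_appendOnes_nonpos hMe hK h1 h2
  -- Even, at least `N` for the criterion, and at least `M` for the size estimates on `g`.
  set n := (N + M) + (N + M) with hn
  have hfev : ∀ x : ℝ, aeval x (X ^ n * g - 1 : ℤ[X]) = x ^ n * aeval x g - 1 := by simp
  have hf0 : aeval b₀ (X ^ n * g - 1 : ℤ[X]) < 0 := by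
    rw [hfev]
    have := aeval_appendOnes_nonpos_of_nonneg (M := M) (by linarith : 0 ≤ b₀) hPr.le (K + 1)
    rw [← hg] at this
    have := mul_nonneg (pow_nonneg (by linarith : 0 ≤ b₀) n) (neg_nonneg.2 this)
    linarith
  have hf1 : 0 < aeval b₁ (X ^ n * g - 1 : ℤ[X]) := by
    rw [hfev]
    have hb₁M : b₀ ^ M ≤ b₁ ^ M := pow_le_pow_left₀ (by linarith) hb₁.le M
    have hMy' : 1 + y₀ ≤ b₁ ^ M * y₀ := hMy.trans (mul_le_mul_of_nonneg_right hb₁M hy₀pos.le)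
    have h1 := aeval_appendOnes_ge (by linarith : 0 ≤ b₁) hMy' le_rfl (K + 1)
    rw [← hg] at h1
    have h2 : b₁ ^ M ≤ b₁ ^ n := pow_le_pow_right₀ (by linarith) (by omega)
    have h3 := mul_le_mul h2 h1 hy₀pos.le (pow_nonneg (by linarith) n)
    linarith
  obtain ⟨b, ⟨hb, hb'⟩, hfb⟩ := intermediate_value_Ioo hb₁.le
    (X ^ n * g - 1 : ℤ[X]).continuous_aeval.continuousOn ⟨hf0, hf1⟩
  have hb1 : 1 < b := hb₀.trans hb
  refine ⟨b, hb, hb'.trans hb₁c, ⟨hb1, ?_⟩, hN n (by omega) ⟨_, rfl⟩ b hb1 hfb⟩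
  have hit := betaMap_iterate_eq_aeval_hornerPoly hb₀ hb (hlt b hb hb') r le_rfl
  simp only [hfev] at hfb
  have hgb : b ^ n * aeval b g = 1 := by linarith
  have hgpos : 0 < aeval b g := pos_of_mul_pos_right (by linarith : 0 < b ^ n * aeval b g)
    (pow_nonneg (by linarith) n)
  have hbM : b₀ ^ M ≤ b ^ M := pow_le_pow_left₀ (by linarith) hb.le M
  have hMε' : 2 ≤ ε * b ^ M := hMε.trans (mul_le_mul_of_nonneg_left hbM hε0.le)
  -- A larger value would give `b ^ n * g(b) ≥ b ^ M * ε ≥ 2`, but this product is `1`.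
  have hgε : aeval b g ≤ ε := by
    by_contra hlt'
    push Not at hlt'
    have h2 : b ^ M ≤ b ^ n := pow_le_pow_right₀ hb1.le (by omega)
    have h3 := mul_le_mul h2 hlt'.le hε0.le (pow_nonneg (by linarith) n)
    linarith
  rw [hg, aeval_appendOnes] at hgpos hgε
  obtain ⟨-, -, k, hk⟩ := exists_betaMap_iterate_eq_iterate hM1 hε1 (hεb.trans hb) hMε' (K + 1) _
    hgpos hgε
  rw [← aeval_appendOnes, ← hg] at hk hgpos
  refine finite_forwardOrbit_of_iterate_eq_zero (r := n + (k + r)) ?_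
  rw [Function.iterate_add_apply _ n, Function.iterate_add_apply _ k, hit, ← hP, hk,
    betaMap_iterate_eq_fract hb1.le hgpos.le (by omega) (by rw [hgb]; exact hb1), hgb,
    Int.fract_one]

theorem Ioi_one_subset_closure :
    Set.Ioi (1 : ℝ) ⊆ closure (parryNumbers ∩ yrrapNumbersᶜ) := by
  intro x hx
  have hx : 1 < x := hx
  refine Metric.mem_closure_iff.2 fun ε hε => ?_
  obtain ⟨b₀, hb₀, r, hr, h⟩ := exists_betaMap_iterate_eq_zero hx (by linarith : x < x + ε / 2)
  obtain ⟨b, h1, h2, hb⟩ := exists_mem_parryNumbers_notMem_yrrapNumbers (hx.trans_le hb₀.1)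
    (by linarith : b₀ < b₀ + ε / 2) hr h
  refine ⟨b, hb, ?_⟩
  rw [dist_comm, Real.dist_eq, abs_of_pos (by linarith [hb₀.1])]
  linarith [hb₀.2]

theorem infinite_parryNumbers_inter_compl_yrrapNumbers :
    (parryNumbers ∩ yrrapNumbersᶜ).Infinite := fun hfin => by
  have h := Ioi_one_subset_closure
  rw [hfin.isClosed.closure_eq] at h
  exact Set.Ioi_infinite (1 : ℝ) (hfin.subset h)

theorem theorem2p7 :
    ((parryNumbers ∩ yrrapNumbersᶜ).Countable ∧ (parryNumbers ∩ yrrapNumbersᶜ).Infinite) ∧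
    ((parryNumbersᶜ ∩ yrrapNumbers).Countable ∧ (parryNumbersᶜ ∩ yrrapNumbers).Infinite) ∧
    {β : ℝ | β ∈ parryNumbersᶜ ∩ yrrapNumbers ∧
      ∃ γ : ℝ, IsConjRoot ℚ β γ ∧ γ ≠ β ∧ 1 < γ ∧ γ < Real.goldenRatio}.Infinite ∧
    Set.Ioi (1 : ℝ) ⊆ closure (parryNumbers ∩ yrrapNumbersᶜ) :=
  ⟨⟨countable_parryNumbers.mono Set.inter_subset_left,
    infinite_parryNumbers_inter_compl_yrrapNumbers⟩,
    ⟨countable_yrrapNumbers.mono Set.inter_subset_right,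
      infinite_yrrapNumbers_conj.mono fun _ h => h.1⟩,
    infinite_yrrapNumbers_conj, Ioi_one_subset_closure⟩
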